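/- Let $F_1=F_2=1$, $F_{n+2}=F_{n+1}+F_n$ be the Fibonacci numbers, and let $\pi(N)$ be the number of primes $p\le N$. There is a function $\varepsilon(N)$ of the real parameter $N$ with $\varepsilon(N)\to 0$ as $N\to\infty$ such that, for $\pi(N)(1+o(1))$ of the primes $p\le N$ as $N\to\infty$, the following holds: for every integer $\lambda$ there exist integers $n_1,\ldots,n_{16}$ with $$1\le n_1,\ldots,n_{16}\le N^{1/2+\varepsilon(N)}\qquad\text{and}\qquad F_{n_1}+\cdots+F_{n_{16}}\equiv\lambda \pmod p .$$ -/

import Mathlib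

open Filter Topology Asymptotics

/-- Every integer `a` is congruent mod `p` to a sum of sixteen Fibonacci numbers `F_{n_i}` whose
indices satisfy `1 ≤ n_i ≤ B` (with `F_1 = F_2 = 1`). -/
def EveryResidueSumOfSixteenFib (p : ℕ) (B : ℝ) : Prop :=
  ∀ a : ℤ, ∃ n : Fin 16 → ℕ,
    (∀ i, 1 ≤ n i ∧ (n i : ℝ) ≤ B) ∧ (∑ i, (Nat.fib (n i) : ℤ)) ≡ a [ZMOD (p : ℤ)]

/-! Let z(p) be the least positive index of a Fibonacci number divisible by p. The argument has two
independent halves.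

If z(p) > 10√p, sixteen summands suffice. Take M slightly above √(2p), A the set of F_{2i+1} and B
the set of Lucas numbers L_{2j}, with M values of each index. Differences of squares of these
numbers factor through Fibonacci numbers of index below z(p), so the elements are distinct mod p and
B is disjoint from -B. A sum-product argument (`exists_eq_sum_eight_mul`) then writes every residue
as a sum of eight products ab, and F_{2i+1} L_{2j} = F_{2i+1+2j} + F_{|2i+1-2j|} turns these into
sixteen Fibonacci numbers with indices at most 10√p. The factor 10 is absorbed by ε(N) = log 10 /
log N.

Almost all primes p ≤ n have z(p) > 10√n (`eventually_card_smallRankPrimes_le`). Counting prime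
factors of F_t for all t ≤ 10√n only gives O(n / log n), the order of π(n) itself, so any constant
factor must still be gained. The gain is the multiplication table idea of Erdős. The rank t divides
p - 1 or p + 1; write p ± 1 = tm, where t and m both have order √n apart from few exceptions. Fix a
finite set Q of primes with E = ∑ 1/q large. By Turán's inequality typical t and m each have about E
prime factors in Q, so p ± 1 has about 2E. A shifted prime normally has only about E, so this is
rare. Atypical t are handled by counting large prime factors of F_t; atypical m, square factors and
the excess of prime factors of p ± 1 are handled by a Brun–Titchmarsh bound obtained from a
Selberg-type sieve. -/

theorem Finset.sq_card_le_card_image_mul_card_collisions {α β : Type*} [DecidableEq β]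
    (s : Finset α) (f : α → β) :
    s.card ^ 2 ≤ (s.image f).card * ((s ×ˢ s).filter fun x => f x.1 = f x.2).card := by
  classical
  have h1 : s.card = ∑ y ∈ s.image f, (s.filter fun x => f x = y).card :=
    Finset.card_eq_sum_card_fiberwise fun x hx => Finset.mem_image_of_mem f hx
  have h2 : ((s ×ˢ s).filter fun x => f x.1 = f x.2).card
      = ∑ y ∈ s.image f, (s.filter fun x => f x = y).card ^ 2 := by
    rw [Finset.card_eq_sum_card_fiberwise (f := fun x : α × α => f x.1) (t := s.image f)]
    · refine Finset.sum_congr rfl fun y _ => ?_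
      rw [sq, ← Finset.card_product]
      congr 1
      ext x
      simp only [Finset.mem_filter, Finset.mem_product]
      constructor
      · rintro ⟨⟨⟨h1, h2⟩, h3⟩, h4⟩
        exact ⟨⟨h1, h4⟩, h2, h3 ▸ h4⟩
      · rintro ⟨⟨h1, h2⟩, h3, h4⟩
        exact ⟨⟨⟨h1, h3⟩, h2.trans h4.symm⟩, h2⟩
    · intro x hx
      simp only [Finset.coe_filter, Finset.mem_product, Set.mem_ofPred_eq] at hx
      exact Finset.mem_image_of_mem f hx.1.1
  rw [h2, h1]
  exact sq_sum_le_card_mul_sum_sq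

/-! ### Sums of eight products in a finite field. -/

section SumProduct

variable {F : Type*} [Field F] [Fintype F] [DecidableEq F]

/-- Number of coincidences `a + ξ b = a' + ξ b'`. -/
def dilateEnergy (A B : Finset F) (ξ : F) : ℕ :=
  (((A ×ˢ B) ×ˢ (A ×ˢ B)).filter fun x => x.1.1 + ξ * x.1.2 = x.2.1 + ξ * x.2.2).card

/-- Exchanging b and b' moves the ξ-terms across the equation. One good ξ therefore makes both A +
ξB and A - ξB large. -/
theorem dilateEnergy_neg (A B : Finset F) (ξ : F) :
    dilateEnergy A B (-ξ) = dilateEnergy A B ξ := by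
  refine Finset.card_bij (fun x _ => ((x.1.1, x.2.2), (x.2.1, x.1.2))) ?_ ?_ ?_
  · intro x hx
    simp only [Finset.mem_filter, Finset.mem_product] at hx ⊢
    exact ⟨⟨⟨hx.1.1.1, hx.1.2.2⟩, hx.1.2.1, hx.1.1.2⟩, by linear_combination hx.2⟩
  · intro x _ y _ h
    simp only [Prod.mk.injEq] at h
    ext <;> simp [h]
  · intro x hx
    simp only [Finset.mem_filter, Finset.mem_product] at hx
    refine ⟨((x.1.1, x.2.2), (x.2.1, x.1.2)), ?_, by simp⟩
    simp only [Finset.mem_filter, Finset.mem_product]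
    exact ⟨⟨⟨hx.1.1.1, hx.1.2.2⟩, hx.1.2.1, hx.1.1.2⟩, by linear_combination hx.2⟩

/-- A diagonal coincidence holds for all q - 1 values of ξ, any other for at most one. -/
theorem sum_dilateEnergy_le (A B : Finset F) :
    ∑ ξ ∈ Finset.univ.erase (0 : F), dilateEnergy A B ξ
      ≤ (Fintype.card F - 1) * (A.card * B.card) + (A.card * B.card) ^ 2 := by
  classical
  simp only [dilateEnergy, Finset.card_filter]
  rw [Finset.sum_comm]
  have hpt : ∀ x ∈ (A ×ˢ B) ×ˢ (A ×ˢ B),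
      (∑ ξ ∈ Finset.univ.erase (0 : F),
        if x.1.1 + ξ * x.1.2 = x.2.1 + ξ * x.2.2 then 1 else 0)
      ≤ (if x.1 = x.2 then Fintype.card F - 1 else 0) + 1 := by
    intro x _
    rw [← Finset.card_filter]
    by_cases h : x.1 = x.2
    · rw [if_pos h]
      refine (Finset.card_filter_le _ _).trans ?_
      rw [Finset.card_erase_of_mem (Finset.mem_univ _), Finset.card_univ]
      omega
    · rw [if_neg h, zero_add, Finset.card_le_one]
      intro ξ hξ η hη
      simp only [Finset.mem_filter, Finset.mem_erase, Finset.mem_univ, and_true] at hξ hη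
      have h1 : (ξ - η) * (x.1.2 - x.2.2) = 0 := by linear_combination hξ.2 - hη.2
      rcases mul_eq_zero.1 h1 with h2 | h2
      · exact sub_eq_zero.1 h2
      · exfalso
        apply h
        ext
        · linear_combination hξ.2 - ξ * h2
        · exact sub_eq_zero.1 h2
  refine (Finset.sum_le_sum hpt).trans ?_
  rw [Finset.sum_add_distrib, Finset.sum_const, Finset.card_product, Finset.card_product,
    ← Finset.sum_filter, Finset.sum_const]
  have : (((A ×ˢ B) ×ˢ (A ×ˢ B)).filter fun x => x.1 = x.2).card ≤ A.card * B.card := by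
    rw [← Finset.card_product]
    refine Finset.card_le_card_of_injOn Prod.fst ?_ ?_
    · intro x hx
      simp only [Finset.coe_filter, Finset.mem_product, Set.mem_ofPred_eq] at hx
      simpa using hx.1.1
    · intro x hx y hy h
      simp only [Finset.coe_filter, Set.mem_ofPred_eq] at hx hy
      exact Prod.ext h (by rw [← hx.2, ← hy.2, h])
  have := Nat.mul_le_mul_right (Fintype.card F - 1) this
  simp only [smul_eq_mul]
  nlinarith

theorem exists_inter_of_card_lt {s t : Finset F} (h : Fintype.card F < s.card + t.card) :
    ∃ x ∈ s, x ∈ t := by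
  by_contra! hne
  have hd : Disjoint s t := Finset.disjoint_left.2 hne
  have := Finset.card_le_univ (s ∪ t)
  rw [Finset.card_union_of_disjoint hd] at this
  omega

/-- If `|A||B| ≥ 2q` and `B` is disjoint from `-B`, every element of the field with `q` elements
is a sum of eight products `a * b`. -/
theorem exists_eq_sum_eight_mul (A B : Finset F) (hq : 5 ≤ Fintype.card F)
    (hAB : 2 * Fintype.card F ≤ A.card * B.card)
    (hB : ∀ b ∈ B, ∀ b' ∈ B, b + b' ≠ 0) (c : F) :
    ∃ a b : Fin 8 → F, (∀ i, a i ∈ A) ∧ (∀ i, b i ∈ B) ∧ ∑ i, a i * b i = c := by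
  classical
  set q := Fintype.card F with hqdef
  set s := A.card * B.card with hs
  -- Averaging over ξ ≠ 0 gives a dilate whose energy is at most the mean.
  obtain ⟨ξ, hξ0, hξ⟩ : ∃ ξ : F, ξ ≠ 0 ∧ (q - 1) * dilateEnergy A B ξ ≤ (q - 1) * s + s ^ 2 := by
    by_contra! hcon
    have h1 : ∑ ξ ∈ Finset.univ.erase (0 : F), ((q - 1) * s + s ^ 2 : ℕ)
        < ∑ ξ ∈ Finset.univ.erase (0 : F), (q - 1) * dilateEnergy A B ξ := by
      refine Finset.sum_lt_sum_of_nonempty ⟨1, by simp⟩ ?_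
      intro ξ hξ
      exact hcon ξ (by simpa using hξ)
    rw [← Finset.mul_sum, Finset.sum_const, Finset.card_erase_of_mem (Finset.mem_univ _),
      Finset.card_univ, smul_eq_mul] at h1
    exact absurd (Nat.mul_le_mul_left (q - 1) (sum_dilateEnergy_le A B)) (not_le.2 h1)
  -- By Cauchy–Schwarz |A + ηB| ≥ s(q - 1)/(s + q - 1), which exceeds q/2 once s ≥ 2q and q ≥ 5.
  have big : ∀ η : F, dilateEnergy A B η = dilateEnergy A B ξ →
      q < 2 * ((A ×ˢ B).image fun x => x.1 + η * x.2).card := by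
    intro η hη
    have h1 := Finset.sq_card_le_card_image_mul_card_collisions (A ×ˢ B)
      (fun x => x.1 + η * x.2)
    rw [Finset.card_product, ← hs] at h1
    change s ^ 2 ≤ _ * dilateEnergy A B η at h1
    rw [hη] at h1
    set X := ((A ×ˢ B).image fun x => x.1 + η * x.2).card
    by_contra! hX
    obtain ⟨r, hr⟩ : ∃ r, q = r + 1 := ⟨q - 1, by omega⟩
    rw [hr] at hξ hX hAB hq
    simp only [Nat.add_sub_cancel] at hξ
    have h2 : r * s ^ 2 ≤ X * (r * s + s ^ 2) :=
      calc r * s ^ 2 ≤ r * (X * dilateEnergy A B ξ) := Nat.mul_le_mul_left _ h1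
        _ = X * (r * dilateEnergy A B ξ) := by ring
        _ ≤ _ := Nat.mul_le_mul_left _ hξ
    have hspos : 0 < s := by omega
    have h3 : r * s ≤ X * (r + s) := by
      refine Nat.le_of_mul_le_mul_left ?_ hspos
      nlinarith
    have h4 : 2 * (r * s) ≤ (r + 1) * (r + s) := by nlinarith
    nlinarith
  have hP := big ξ rfl
  have hM := big (-ξ) (dilateEnergy_neg A B ξ)
  -- A - ξB fills more than half of the field, so it meets its own negative.
  obtain ⟨a₁, ha₁, b₁, hb₁, a₂, ha₂, b₂, hb₂, hrel⟩ : ∃ a₁ ∈ A, ∃ b₁ ∈ B, ∃ a₂ ∈ A, ∃ b₂ ∈ B,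
      a₁ + a₂ = ξ * (b₁ + b₂) := by
    obtain ⟨x, hx, hx'⟩ := exists_inter_of_card_lt
      (s := (A ×ˢ B).image fun x => x.1 + (-ξ) * x.2)
      (t := ((A ×ˢ B).image fun x => x.1 + (-ξ) * x.2).image fun y => -y) (by
        rw [Finset.card_image_of_injective _ neg_injective]; omega)
    simp only [Finset.mem_image, Finset.mem_product, Prod.exists] at hx hx'
    obtain ⟨a₁, b₁, ⟨h1, h2⟩, h3⟩ := hx
    obtain ⟨y, ⟨a₂, b₂, ⟨h4, h5⟩, h6⟩, h7⟩ := hx'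
    exact ⟨a₁, h1, b₁, h2, a₂, h4, b₂, h5, by linear_combination h3 - h7 + h6⟩
  have hb := hB b₁ hb₁ b₂ hb₂
  -- A + ξB likewise meets its reflection, so c/(b₁ + b₂) is a sum of two of its elements.
  obtain ⟨x, hx, hx'⟩ := exists_inter_of_card_lt
      (s := (A ×ˢ B).image fun x => x.1 + ξ * x.2)
      (t := ((A ×ˢ B).image fun x => x.1 + ξ * x.2).image fun y => c / (b₁ + b₂) - y) (by
        rw [Finset.card_image_of_injective _ sub_right_injective]; omega)
  simp only [Finset.mem_image, Finset.mem_product, Prod.exists] at hx hx'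
  obtain ⟨a₃, b₃, ⟨h1, h2⟩, h3⟩ := hx
  obtain ⟨y, ⟨a₄, b₄, ⟨h4, h5⟩, h6⟩, h7⟩ := hx'
  have hc : c = (b₁ + b₂) * (a₃ + ξ * b₃ + (a₄ + ξ * b₄)) := by
    have : c = (b₁ + b₂) * (c / (b₁ + b₂)) := by field_simp
    rw [this]
    linear_combination (b₁ + b₂) * (h7 - h6 - h3)
  -- Replacing ξ(b₁ + b₂) by a₁ + a₂ removes ξ: c = (b₁ + b₂)(a₃ + a₄) + (a₁ + a₂)(b₃ + b₄).
  refine ⟨![a₃, a₃, a₄, a₄, a₁, a₂, a₁, a₂], ![b₁, b₂, b₁, b₂, b₃, b₃, b₄, b₄], ?_, ?_, ?_⟩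
  · intro i; fin_cases i <;> assumption
  · intro i; fin_cases i <;> assumption
  · simp only [Fin.sum_univ_eight, hc]
    simp
    linear_combination (b₃ + b₄) * hrel

end SumProduct

/-! ### Fibonacci and Lucas numbers modulo a prime of large rank. -/

section Fibonacci

/-- The Lucas number `L_{2j}`, in terms of Fibonacci numbers. -/
def lucasTwoMul (j : ℕ) : ℤ := 2 * Nat.fib (2 * j + 1) - Nat.fib (2 * j)

/-- The addition formula at ±2j. The odd index matters: F is even on odd indices, so a negative
difference may be replaced by its absolute value, and that value is never 0. -/
theorem fib_odd_mul_lucasTwoMul (i j : ℕ) :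
    (Nat.fib (2 * i + 1) : ℤ) * lucasTwoMul j =
      Nat.fib (2 * i + 1 + 2 * j) + Nat.fib ((2 * i + 1 - 2 * j : ℤ).natAbs) := by
  have hodd : Odd (2 * (i : ℤ) + 1 - 2 * j) := ⟨i - j, by ring⟩
  rw [← Int.fib_of_odd hodd, ← Int.fib_natCast (2 * i + 1 + 2 * j), ← Int.fib_natCast (2 * i + 1),
    lucasTwoMul, ← Int.fib_natCast (2 * j + 1), ← Int.fib_natCast (2 * j)]
  push_cast
  have h1 := Int.fib_add (2 * i + 1) (2 * j)
  have h2 := Int.fib_add (2 * i + 1) (-(2 * j))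
  have h3 : Int.fib (-(2 * j)) = -Int.fib (2 * j) := by
    rw [Int.fib_neg, if_pos (even_two_mul _)]
  have h4 : Int.fib (-(2 * (j : ℤ)) + 1) = Int.fib (2 * j - 1) := by
    rw [show -(2 * (j : ℤ)) + 1 = -(2 * j - 1) by ring, Int.fib_neg, if_neg]
    rw [Int.not_even_iff_odd]
    exact ⟨j - 1, by ring⟩
  have h5 := Int.fib_add_two (2 * j - 1)
  rw [show 2 * (j : ℤ) - 1 + 2 = 2 * j + 1 by ring, show 2 * (j : ℤ) - 1 + 1 = 2 * j by ring] at h5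
  rw [show 2 * (i : ℤ) + 1 - 2 * j = 2 * i + 1 + -(2 * j) by ring, h1, h2, h3, h4]
  linear_combination (Int.fib (2 * i + 1)) * h5

/-- Reduces distinctness of Lucas numbers up to sign to distinctness of Fibonacci squares. -/
theorem lucasTwoMul_sq (j : ℕ) : lucasTwoMul j ^ 2 = 5 * (Nat.fib (2 * j) : ℤ) ^ 2 + 4 := by
  have h1 := Int.fib_succ_mul_fib_pred_sub_fib_sq (2 * j)
  have h5 := Int.fib_add_two (2 * j - 1)
  rw [show 2 * (j : ℤ) - 1 + 2 = 2 * j + 1 by ring, show 2 * (j : ℤ) - 1 + 1 = 2 * j by ring] at h5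
  have h6 : ((-1 : ℤ)) ^ (2 * (j : ℤ)).natAbs = 1 :=
    Even.neg_one_pow (by rw [Int.natAbs_mul]; exact even_two_mul _)
  rw [lucasTwoMul, ← Int.fib_natCast (2 * j + 1), ← Int.fib_natCast (2 * j)]
  push_cast
  rw [h6] at h1
  linear_combination 4 * h1 + 4 * Int.fib (2 * j + 1) * h5

/-- With j = i + 2k the factors have indices j - i and j + i. Neither vanishes mod p when j + i is
below the rank. -/
theorem fib_sq_sub_fib_sq (i k : ℕ) :
    (Nat.fib (i + 2 * k) : ℤ) ^ 2 - (Nat.fib i : ℤ) ^ 2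
      = Nat.fib (2 * k) * Nat.fib (2 * i + 2 * k) := by
  have h := Int.fib_add_sq_sub_fib_mul_fib_add_two_mul (2 * k) i
  have h6 : ((-1 : ℤ)) ^ (2 * (k : ℤ)).natAbs = 1 :=
    Even.neg_one_pow (by rw [Int.natAbs_mul]; exact even_two_mul _)
  rw [h6] at h
  rw [← Int.fib_natCast (i + 2 * k), ← Int.fib_natCast i, ← Int.fib_natCast (2 * k),
    ← Int.fib_natCast (2 * i + 2 * k)]
  push_cast
  rw [add_comm (i : ℤ), add_comm (2 * (i : ℤ))]
  linear_combination h

variable {p : ℕ} [Fact p.Prime] {z : ℕ}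

theorem fib_sq_ne_of_lt (h : ∀ k, 0 < k → k < z → ¬ p ∣ Nat.fib k) {i j : ℕ} (hij : i < j)
    (hpar : 2 ∣ j - i) (hz : i + j < z) :
    ((Nat.fib i : ZMod p)) ^ 2 ≠ (Nat.fib j : ZMod p) ^ 2 := by
  obtain ⟨k, hk⟩ := hpar
  obtain rfl : j = i + 2 * k := by omega
  intro heq
  have h1 := congrArg (Int.cast : ℤ → ZMod p) (fib_sq_sub_fib_sq i k)
  push_cast at h1
  rw [heq, sub_self, eq_comm, mul_eq_zero, ZMod.natCast_eq_zero_iff, ZMod.natCast_eq_zero_iff] at h1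
  rcases h1 with h1 | h1
  · exact h _ (by omega) (by omega) h1
  · exact h _ (by omega) (by omega) h1

theorem fib_sq_injOn (h : ∀ k, 0 < k → k < z → ¬ p ∣ Nat.fib k) {i j : ℕ}
    (hpar : (i : ℤ) ≡ j [ZMOD 2]) (hz : i + j < z)
    (heq : ((Nat.fib i : ZMod p)) ^ 2 = (Nat.fib j : ZMod p) ^ 2) : i = j := by
  rcases lt_trichotomy i j with hij | hij | hij
  · exact absurd heq (fib_sq_ne_of_lt h hij (by have := hpar.dvd; omega) hz)
  · exact hij
  · exact absurd heq.symm (fib_sq_ne_of_lt h hij (by have := hpar.dvd; omega) (by omega))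

theorem lucasTwoMul_eq_of_sq_eq (hp : 7 ≤ p) (h : ∀ k, 0 < k → k < z → ¬ p ∣ Nat.fib k) {i j : ℕ}
    (hz : 2 * i + 2 * j < z)
    (heq : (lucasTwoMul i : ZMod p) ^ 2 = (lucasTwoMul j : ZMod p) ^ 2) : i = j := by
  have h1 := congrArg (Int.cast : ℤ → ZMod p) (lucasTwoMul_sq i)
  have h2 := congrArg (Int.cast : ℤ → ZMod p) (lucasTwoMul_sq j)
  push_cast at h1 h2
  have h5 : (5 : ZMod p) ≠ 0 := by
    intro h0
    have := (ZMod.natCast_eq_zero_iff 5 p).1 (by exact_mod_cast h0)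
    exact absurd (Nat.le_of_dvd (by norm_num) this) (by omega)
  have h3 : ((Nat.fib (2 * i) : ZMod p)) ^ 2 = (Nat.fib (2 * j) : ZMod p) ^ 2 := by
    apply mul_left_cancel₀ h5
    linear_combination heq - h1 + h2
  have := fib_sq_injOn h (by simp [Int.ModEq]) hz h3
  omega

/-- Opposite values have equal squares, which forces i = j and then L_{2i} = 0. Since F_{4i} =
F_{2i} L_{2i}, this contradicts 4i < z. -/
theorem lucasTwoMul_add_ne_zero (hp : 7 ≤ p) (h : ∀ k, 0 < k → k < z → ¬ p ∣ Nat.fib k) {i j : ℕ}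
    (hi : 0 < i) (hz : 2 * i + 2 * j < z) :
    (lucasTwoMul i : ZMod p) + lucasTwoMul j ≠ 0 := by
  intro h0
  have hij : i = j := lucasTwoMul_eq_of_sq_eq hp h hz (by
    rw [eq_neg_of_add_eq_zero_left h0, neg_sq])
  subst hij
  have h2 : (2 : ZMod p) ≠ 0 := by
    intro h0
    have := (ZMod.natCast_eq_zero_iff 2 p).1 (by exact_mod_cast h0)
    exact absurd (Nat.le_of_dvd (by norm_num) this) (by omega)
  rw [← two_mul, mul_eq_zero, or_iff_right h2] at h0
  refine h (2 * (2 * i)) (by omega) (by omega) ?_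
  rw [← ZMod.natCast_eq_zero_iff, ← Int.cast_natCast, ← Int.fib_natCast]
  push_cast
  rw [Int.fib_two_mul]
  have : 2 * Int.fib (2 * i + 1) - Int.fib (2 * i) = lucasTwoMul i := by
    rw [lucasTwoMul, ← Int.fib_natCast, ← Int.fib_natCast]
    push_cast
    rfl
  rw [this]
  push_cast
  rw [h0, mul_zero]

/-- If no Fibonacci number of index below a large multiple of `√p` vanishes mod `p`, then sixteen
Fibonacci numbers with indices `O(√p)` represent every residue. -/
theorem everyResidueSumOfSixteenFib_of_rank (hp : 7 ≤ p)
    (h : ∀ k, 0 < k → k < z → ¬ p ∣ Nat.fib k) (hz : 100 * p ≤ z ^ 2) :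
    EveryResidueSumOfSixteenFib p (10 * √(p : ℝ)) := by
  -- M² ≥ 2p is what the sum-product step needs, while 4M bounds every index that occurs and stays
  -- below both z and 10√p.
  set M := Nat.sqrt (2 * p) + 1 with hM
  have hM2 : 2 * p ≤ M * M := (Nat.lt_succ_sqrt (2 * p)).le
  have hMz : (4 * M) ^ 2 < 100 * p := by
    have h1 := Nat.sqrt_le' (2 * p)
    have h2 : 3 ≤ Nat.sqrt (2 * p) := by rw [Nat.le_sqrt]; omega
    rw [hM]
    nlinarith
  have hMz' : 4 * M < z := lt_of_pow_lt_pow_left₀ 2 (by positivity) (hMz.trans_le hz)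
  intro c
  let fA : ℕ → ZMod p := fun i => Nat.fib (2 * i + 1)
  -- The shift by one keeps the Lucas index positive, as `lucasTwoMul_add_ne_zero` requires.
  let fB : ℕ → ZMod p := fun j => lucasTwoMul (j + 1)
  have hA : ((Finset.range M).image fA).card = M := by
    rw [Finset.card_image_of_injOn, Finset.card_range]
    intro i hi j hj hij
    simp only [Finset.coe_range, Set.mem_Iio] at hi hj
    have : 2 * i + 1 = 2 * j + 1 := fib_sq_injOn (p := p) h (by
      simp [Int.ModEq, Int.add_emod]) (by omega) (by
        have : fA i = fA j := hij
        simp only [fA] at this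
        rw [this])
    omega
  have hB : ((Finset.range M).image fB).card = M := by
    rw [Finset.card_image_of_injOn, Finset.card_range]
    intro i hi j hj hij
    simp only [Finset.coe_range, Set.mem_Iio] at hi hj
    have : i + 1 = j + 1 := lucasTwoMul_eq_of_sq_eq hp h (by omega) (by
      have : fB i = fB j := hij
      simp only [fB] at this
      rw [this])
    omega
  obtain ⟨a, b, ha, hb, hab⟩ := exists_eq_sum_eight_mul ((Finset.range M).image fA)
    ((Finset.range M).image fB) (by rw [ZMod.card]; omega) (by rw [ZMod.card, hA, hB]; exact hM2)
    (by
      intro b hb b' hb'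
      simp only [Finset.mem_image, Finset.mem_range] at hb hb'
      obtain ⟨i, hi, rfl⟩ := hb
      obtain ⟨j, hj, rfl⟩ := hb'
      exact lucasTwoMul_add_ne_zero hp h (by omega) (by omega)) (c : ZMod p)
  simp only [Finset.mem_image, Finset.mem_range] at ha hb
  choose i hi hai using ha
  choose j hj hbj using hb
  have key : ∀ m : ℕ, m ≤ 4 * M → (m : ℝ) ≤ 10 * √(p : ℝ) := by
    intro m hm
    have h1 : ((m : ℝ)) ^ 2 ≤ 100 * p := by
      have : m ^ 2 ≤ 100 * p := (Nat.pow_le_pow_left hm 2).trans hMz.le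
      exact_mod_cast this
    rw [show (10 : ℝ) * √(p : ℝ) = √(100 * p) by
      rw [Real.sqrt_mul (by norm_num), show (100 : ℝ) = 10 ^ 2 by norm_num,
        Real.sqrt_sq (by norm_num)]]
    exact Real.le_sqrt_of_sq_le h1
  let n : Fin 8 → Fin 2 → ℕ := fun k =>
    ![2 * i k + 1 + 2 * (j k + 1), (2 * (i k : ℤ) + 1 - 2 * (j k + 1 : ℕ)).natAbs]
  refine ⟨fun m => n (finProdFinEquiv.symm m : Fin 8 × Fin 2).1
    (finProdFinEquiv.symm m : Fin 8 × Fin 2).2, ?_, ?_⟩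
  · intro m
    dsimp only
    generalize (finProdFinEquiv.symm m : Fin 8 × Fin 2) = x
    have h1 := hi x.1
    have h2 := hj x.1
    have h3 : 1 ≤ n x.1 x.2 ∧ n x.1 x.2 ≤ 4 * M := by
      generalize x.2 = r
      fin_cases r
      · simp only [n]
        simp
        omega
      · simp only [n]
        simp
        omega
    exact ⟨h3.1, key _ h3.2⟩
  · rw [← ZMod.intCast_eq_intCast_iff]
    rw [← hab]
    push_cast
    rw [← Equiv.sum_comp (finProdFinEquiv : Fin 8 × Fin 2 ≃ Fin 16), Fintype.sum_prod_type]
    refine Finset.sum_congr rfl fun k _ => ?_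
    simp only [Equiv.symm_apply_apply, Fin.sum_univ_two]
    rw [← hai, ← hbj]
    have := congrArg (Int.cast : ℤ → ZMod p) (fib_odd_mul_lucasTwoMul (i k) (j k + 1))
    push_cast at this
    simp only [fA, fB, n]
    push_cast
    rw [this]

/-- An odd prime other than `5` divides `F_{p-1} F_{p+1}`. -/
theorem dvd_fib_pred_or_dvd_fib_succ (hp : 7 ≤ p) :
    p ∣ Nat.fib (p - 1) ∨ p ∣ Nat.fib (p + 1) := by
  obtain ⟨r, rfl⟩ : ∃ r, p = r + 1 := ⟨p - 1, by omega⟩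
  have hQ : ∀ n : ℕ, (!![1, 1; 1, 0] : Matrix (Fin 2) (Fin 2) (ZMod (r + 1))) ^ (n + 1)
      = !![(Nat.fib (n + 2) : ZMod (r + 1)), Nat.fib (n + 1); Nat.fib (n + 1), Nat.fib n] := by
    intro n
    induction n with
    | zero => simp
    | succ n ih =>
      rw [pow_succ, ih, Nat.fib_add_two (n := n + 1), Nat.fib_add_two (n := n)]
      ext i j
      fin_cases i <;> fin_cases j <;> simp [add_comm]
  -- In characteristic p the trace of the p-th power is the p-th power of the trace, so F_{p+1} +
  -- F_{p-1} = 1 mod p.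
  have htr := ZMod.trace_pow_card (p := r + 1)
    (!![1, 1; 1, 0] : Matrix (Fin 2) (Fin 2) (ZMod (r + 1)))
  rw [hQ, Matrix.trace_fin_two_of, Matrix.trace_fin_two_of, add_zero, one_pow] at htr
  have hodd : Odd (r + 1) := (Fact.out : (r + 1).Prime).odd_of_ne_two (by omega)
  have hcas := congrArg (Int.cast : ℤ → ZMod (r + 1))
    (Int.fib_succ_mul_fib_pred_sub_fib_sq ((r + 1 : ℕ) : ℤ))
  rw [Int.natAbs_natCast, hodd.neg_one_pow, show (((r + 1 : ℕ) : ℤ) - 1) = (r : ℕ) by simp,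
    show (((r + 1 : ℕ) : ℤ) + 1) = (r + 2 : ℕ) by push_cast; ring, Int.fib_natCast,
    Int.fib_natCast, Int.fib_natCast] at hcas
  push_cast at hcas
  have hrec : (Nat.fib (r + 2) : ZMod (r + 1)) = Nat.fib r + Nat.fib (r + 1) := by
    rw [Nat.fib_add_two]; push_cast; rfl
  have h5 : (5 : ZMod (r + 1)) ≠ 0 := by
    intro h0
    have := (ZMod.natCast_eq_zero_iff 5 (r + 1)).1 (by exact_mod_cast h0)
    exact absurd (Nat.le_of_dvd (by norm_num) this) (by omega)
  -- Put x = F_{p-1}, y = F_{p+1}. Cassini gives xy - (y - x)² = -1, and (y - x)² = 1 - 4xy because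
  -- x + y = 1; hence 5xy = 0.
  have : (5 : ZMod (r + 1)) * (Nat.fib r * Nat.fib (r + 2)) = 0 := by
    have hsub : (Nat.fib (r + 1) : ZMod (r + 1)) = Nat.fib (r + 2) - Nat.fib r := by
      rw [hrec]; ring
    rw [hsub] at hcas
    linear_combination hcas + (Nat.fib (r + 2) + Nat.fib r + 1 : ZMod (r + 1)) * htr
  rw [mul_eq_zero, or_iff_right h5, mul_eq_zero, ZMod.natCast_eq_zero_iff,
    ZMod.natCast_eq_zero_iff] at this
  simpa using this

end Fibonacci

/-! ### A Selberg-type upper-bound sieve. -/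

section SelbergSieve

open ArithmeticFunction
open scoped ArithmeticFunction.Moebius

/-- Squarefree `k ≤ D` coprime to `m`. -/
def sieveSupport (m D : ℕ) : Finset ℕ :=
  (Finset.Icc 1 D).filter fun k => Squarefree k ∧ k.Coprime m

theorem mem_sieveSupport {m D k : ℕ} :
    k ∈ sieveSupport m D ↔ (1 ≤ k ∧ k ≤ D) ∧ Squarefree k ∧ k.Coprime m := by
  simp [sieveSupport]

theorem mem_sieveSupport_of_dvd {m D k d : ℕ} (hk : k ∈ sieveSupport m D) (hd : d ∣ k) :
    d ∈ sieveSupport m D := by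
  rw [mem_sieveSupport] at hk ⊢
  exact ⟨⟨Nat.pos_of_dvd_of_pos hd hk.1.1, (Nat.le_of_dvd hk.1.1 hd).trans hk.1.2⟩,
    hk.2.1.squarefree_of_dvd hd, hk.2.2.coprime_dvd_left hd⟩

/-- The normalising sum of the sieve weights. -/
noncomputable def sieveMass (m D : ℕ) : ℝ := ∑ k ∈ sieveSupport m D, (1 / k : ℝ)

/-- Selberg-type weights. -/
noncomputable def sieveWeight (m D d : ℕ) : ℝ :=
  μ d * d / sieveMass m D * ∑ j ∈ (sieveSupport m D).filter (d ∣ ·), (1 / j : ℝ)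

theorem one_mem_sieveSupport {m D : ℕ} (hD : 1 ≤ D) : 1 ∈ sieveSupport m D := by
  simp [mem_sieveSupport, hD]

theorem sieveMass_pos {m D : ℕ} (hD : 1 ≤ D) : 0 < sieveMass m D :=
  Finset.sum_pos (fun k hk => by
    have := (mem_sieveSupport.1 hk).1.1
    positivity) ⟨1, one_mem_sieveSupport hD⟩

theorem sieveWeight_one {m D : ℕ} (hD : 1 ≤ D) : sieveWeight m D 1 = 1 := by
  have := sieveMass_pos (m := m) hD
  have h1 : ∑ j ∈ (sieveSupport m D).filter (1 ∣ ·), (1 / j : ℝ) = sieveMass m D := by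
    rw [sieveMass]
    congr 1
    simp
  rw [sieveWeight, h1]
  simp [this.ne']

theorem abs_sieveWeight_le {m D : ℕ} (hD : 1 ≤ D) (d : ℕ) : |sieveWeight m D d| ≤ d := by
  have hG := sieveMass_pos (m := m) hD
  have hle : ∑ j ∈ (sieveSupport m D).filter (d ∣ ·), (1 / j : ℝ) ≤ sieveMass m D :=
    Finset.sum_le_sum_of_subset_of_nonneg (Finset.filter_subset _ _) fun _ _ _ => by positivity
  have h0 : 0 ≤ ∑ j ∈ (sieveSupport m D).filter (d ∣ ·), (1 / j : ℝ) :=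
    Finset.sum_nonneg fun _ _ => by positivity
  have hmu : |(μ d : ℝ)| ≤ 1 := by exact_mod_cast abs_moebius_le_one
  rw [sieveWeight, abs_mul, abs_div, abs_mul, abs_of_pos hG, abs_of_nonneg h0, Nat.abs_cast,
    div_mul_eq_mul_div, div_le_iff₀ hG]
  exact mul_le_mul (mul_le_of_le_one_left (by positivity) hmu) hle h0 (by positivity)

/-- For j = kn squarefree, the relevant divisors are ke with e ∣ n, and μ(ke) = μ(k)μ(e). This is
the inversion that diagonalises the sieve form. -/
theorem sum_moebius_divisors_filter_dvd {j k : ℕ} (hj : Squarefree j) :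
    ∑ d ∈ j.divisors.filter (k ∣ ·), (μ d : ℝ) = if j = k then (μ k : ℝ) else 0 := by
  by_cases hkj : k ∣ j
  · obtain ⟨n, rfl⟩ := hkj
    have hcop : k.Coprime n := Nat.coprime_of_squarefree_mul hj
    have hk0 : k ≠ 0 := fun h => by simp [h] at hj
    have hn0 : n ≠ 0 := fun h => by simp [h] at hj
    have himg : (k * n).divisors.filter (k ∣ ·) = n.divisors.image (k * ·) := by
      ext d
      simp only [Finset.mem_filter, Nat.mem_divisors, Finset.mem_image]
      constructor
      · rintro ⟨⟨h1, _⟩, e, rfl⟩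
        exact ⟨e, ⟨Nat.dvd_of_mul_dvd_mul_left (Nat.pos_of_ne_zero hk0) h1, hn0⟩, rfl⟩
      · rintro ⟨e, ⟨h1, _⟩, rfl⟩
        exact ⟨⟨Nat.mul_dvd_mul_left k h1, mul_ne_zero hk0 hn0⟩, dvd_mul_right _ _⟩
    rw [himg, Finset.sum_image fun x _ y _ h => Nat.eq_of_mul_eq_mul_left
      (Nat.pos_of_ne_zero hk0) h]
    have h1 : ∀ e ∈ n.divisors, (μ (k * e) : ℝ) = μ k * μ e := by
      intro e he
      rw [isMultiplicative_moebius.map_mul_of_coprime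
        (hcop.coprime_dvd_right (Nat.dvd_of_mem_divisors he))]
      push_cast
      rfl
    rw [Finset.sum_congr rfl h1, ← Finset.mul_sum]
    have h2 : ∑ e ∈ n.divisors, (μ e : ℝ) = if n = 1 then 1 else 0 := by
      have := congrArg (fun f => f n) (coe_moebius_mul_coe_zeta (R := ℝ))
      simp only [coe_mul_zeta_apply, one_apply] at this
      simpa using this
    rw [h2]
    have h3 : k * n = k ↔ n = 1 := by
      constructor
      · intro h; exact Nat.eq_of_mul_eq_mul_left (Nat.pos_of_ne_zero hk0) (by simpa using h)
      · rintro rfl; simp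
    simp [h3]
  · rw [Finset.sum_eq_zero, if_neg]
    · rintro rfl; exact hkj dvd_rfl
    · intro d hd
      simp only [Finset.mem_filter, Nat.mem_divisors] at hd
      exact absurd (hd.2.trans hd.1.1) hkj

/-- These sums are the diagonal coordinates of the quadratic form; the weights were defined by
inverting this relation. -/
theorem sum_sieveWeight_div {m D k : ℕ} (hk : k ∈ sieveSupport m D) :
    ∑ d ∈ (sieveSupport m D).filter (k ∣ ·), sieveWeight m D d / d
      = μ k / k / sieveMass m D := by
  have h1 : ∀ d ∈ (sieveSupport m D).filter (k ∣ ·), sieveWeight m D d / d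
      = ∑ j ∈ sieveSupport m D, if d ∣ j then (1 / j : ℝ) / sieveMass m D * μ d else 0 := by
    intro d hd
    have hd0 : (d : ℝ) ≠ 0 := by
      have := (mem_sieveSupport.1 (Finset.mem_filter.1 hd).1).1.1
      positivity
    rw [sieveWeight, ← Finset.sum_filter, Finset.mul_sum, Finset.sum_div]
    refine Finset.sum_congr rfl fun j _ => ?_
    field_simp
  rw [Finset.sum_congr rfl h1, Finset.sum_comm]
  have h2 : ∀ j ∈ sieveSupport m D, (∑ d ∈ (sieveSupport m D).filter (k ∣ ·),
      if d ∣ j then (1 / j : ℝ) / sieveMass m D * μ d else 0)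
      = if j = k then μ k / k / sieveMass m D else 0 := by
    intro j hj
    rw [← Finset.sum_filter, ← Finset.mul_sum]
    have h3 : ((sieveSupport m D).filter (k ∣ ·)).filter (· ∣ j)
        = j.divisors.filter (k ∣ ·) := by
      ext d
      simp only [Finset.mem_filter, Nat.mem_divisors]
      constructor
      · rintro ⟨⟨_, h⟩, h'⟩
        exact ⟨⟨h', (mem_sieveSupport.1 hj).2.1.ne_zero⟩, h⟩
      · rintro ⟨⟨h, _⟩, h'⟩
        exact ⟨⟨mem_sieveSupport_of_dvd hj h, h'⟩, h⟩
    rw [h3, sum_moebius_divisors_filter_dvd (mem_sieveSupport.1 hj).2.1]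
    split_ifs with h
    · subst h; ring
    · simp
  rw [Finset.sum_congr rfl h2, Finset.sum_ite_eq' (sieveSupport m D) k, if_pos hk]

/-- Writing 1/lcm = gcd/(de) and gcd = ∑ φ(k) over common divisors k makes the form a sum of φ(k)
times squares. The crude bound φ(k) ≤ k then leaves the mass divided by its square. -/
theorem sum_sieveWeight_mul_div_lcm_le {m D : ℕ} (hD : 1 ≤ D) :
    ∑ d ∈ sieveSupport m D, ∑ e ∈ sieveSupport m D,
      sieveWeight m D d * sieveWeight m D e / (d.lcm e : ℝ) ≤ 1 / sieveMass m D := by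
  have hG := sieveMass_pos (m := m) hD
  have h1 : ∀ d ∈ sieveSupport m D, ∀ e ∈ sieveSupport m D,
      sieveWeight m D d * sieveWeight m D e / (d.lcm e : ℝ)
      = ∑ k ∈ sieveSupport m D, (Nat.totient k : ℝ) *
        ((if k ∣ d then sieveWeight m D d / d else 0) *
          (if k ∣ e then sieveWeight m D e / e else 0)) := by
    intro d hd e he
    have hd0 : (d : ℝ) ≠ 0 := by
      have := (mem_sieveSupport.1 hd).1.1
      positivity
    have he0 : (e : ℝ) ≠ 0 := by
      have := (mem_sieveSupport.1 he).1.1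
      positivity
    have hl0 : (d.lcm e : ℝ) ≠ 0 := by
      have := Nat.lcm_pos (mem_sieveSupport.1 hd).1.1 (mem_sieveSupport.1 he).1.1
      positivity
    have hgl : (d.gcd e : ℝ) * d.lcm e = d * e := by exact_mod_cast Nat.gcd_mul_lcm d e
    have hg : (d.gcd e : ℝ) = ∑ k ∈ sieveSupport m D,
        if k ∣ d ∧ k ∣ e then (Nat.totient k : ℝ) else 0 := by
      rw [← Finset.sum_filter, ← Nat.sum_totient (d.gcd e)]
      push_cast
      refine Finset.sum_congr ?_ fun _ _ => rfl
      ext k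
      simp only [Finset.mem_filter, Nat.mem_divisors, Nat.dvd_gcd_iff]
      constructor
      · rintro ⟨h, _⟩
        exact ⟨mem_sieveSupport_of_dvd hd h.1, h⟩
      · rintro ⟨_, h⟩
        exact ⟨h, (Nat.gcd_pos_of_pos_left e (mem_sieveSupport.1 hd).1.1).ne'⟩
    have h2 : sieveWeight m D d * sieveWeight m D e / (d.lcm e : ℝ)
        = (d.gcd e : ℝ) * (sieveWeight m D d / d * (sieveWeight m D e / e)) := by
      field_simp
      linear_combination -(sieveWeight m D d * sieveWeight m D e) * hgl
    rw [h2, hg, Finset.sum_mul]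
    refine Finset.sum_congr rfl fun k _ => ?_
    by_cases hkd : k ∣ d <;> by_cases hke : k ∣ e <;> simp [hkd, hke]
  rw [Finset.sum_congr rfl fun d hd => Finset.sum_congr rfl fun e he => h1 d hd e he]
  have h3 : ∑ d ∈ sieveSupport m D, ∑ e ∈ sieveSupport m D, ∑ k ∈ sieveSupport m D,
      (Nat.totient k : ℝ) * ((if k ∣ d then sieveWeight m D d / d else 0) *
          (if k ∣ e then sieveWeight m D e / e else 0))
      = ∑ k ∈ sieveSupport m D, (Nat.totient k : ℝ) * (μ k / k / sieveMass m D) ^ 2 := by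
    have : ∀ d ∈ sieveSupport m D, ∑ e ∈ sieveSupport m D, ∑ k ∈ sieveSupport m D,
      (Nat.totient k : ℝ) * ((if k ∣ d then sieveWeight m D d / d else 0) *
          (if k ∣ e then sieveWeight m D e / e else 0))
        = ∑ k ∈ sieveSupport m D, ∑ e ∈ sieveSupport m D,
      (Nat.totient k : ℝ) * ((if k ∣ d then sieveWeight m D d / d else 0) *
          (if k ∣ e then sieveWeight m D e / e else 0)) := fun d _ => Finset.sum_comm
    rw [Finset.sum_congr rfl this, Finset.sum_comm]
    refine Finset.sum_congr rfl fun k hk => ?_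
    rw [← sum_sieveWeight_div hk, sq, Finset.sum_filter, Finset.sum_mul_sum, Finset.mul_sum]
    exact Finset.sum_congr rfl fun d _ => (Finset.mul_sum _ _ _).symm
  rw [h3]
  have h4 : ∀ k ∈ sieveSupport m D, (Nat.totient k : ℝ) * (μ k / k / sieveMass m D) ^ 2
      ≤ (1 / k : ℝ) * (1 / sieveMass m D ^ 2) := by
    intro k hk
    have hk0 : (0 : ℝ) < k := by
      have := (mem_sieveSupport.1 hk).1.1
      positivity
    have hmu : ((μ k : ℝ)) ^ 2 ≤ 1 := by
      rw [← sq_abs]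
      have : |(μ k : ℝ)| ≤ 1 := by exact_mod_cast abs_moebius_le_one
      nlinarith [abs_nonneg (μ k : ℝ)]
    have ht : (Nat.totient k : ℝ) ≤ k := by exact_mod_cast Nat.totient_le k
    calc (Nat.totient k : ℝ) * (μ k / k / sieveMass m D) ^ 2
        = (Nat.totient k * (μ k : ℝ) ^ 2) * (1 / (k ^ 2 * sieveMass m D ^ 2)) := by
          field_simp
      _ ≤ (k * 1) * (1 / (k ^ 2 * sieveMass m D ^ 2)) := by
          gcongr
      _ = _ := by field_simp
  refine (Finset.sum_le_sum h4).trans ?_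
  rw [← Finset.sum_mul]
  change sieveMass m D * _ ≤ _
  rw [show sieveMass m D * (1 / sieveMass m D ^ 2) = 1 / sieveMass m D by field_simp]

/-- Upper-bound sieve for a finite set equidistributed in the classes `0` mod `d`, for `d`
coprime to `m`. -/
theorem card_primes_le_of_equidistributed {m D : ℕ} (hD : 1 ≤ D) (S : Finset ℕ) {X : ℝ} (hX : 0 ≤ X)
    (hS : ∀ d : ℕ, 0 < d → d.Coprime m → |((S.filter (d ∣ ·)).card : ℝ) - X / d| ≤ 1) :
    ((S.filter fun p => p.Prime ∧ D < p).card : ℝ) ≤ X * (1 / sieveMass m D) + (D : ℝ) ^ 4 := by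
  set w := sieveWeight m D with hw
  set K := sieveSupport m D with hK
  have h1 : ((S.filter fun p => p.Prime ∧ D < p).card : ℝ)
      ≤ ∑ x ∈ S, (∑ d ∈ K.filter (· ∣ x), w d) ^ 2 := by
    rw [Finset.card_eq_sum_ones]
    push_cast
    refine le_trans (Finset.sum_le_sum fun p hp => ?_)
      (Finset.sum_le_sum_of_subset_of_nonneg (Finset.filter_subset _ _)
        fun _ _ _ => sq_nonneg _)
    have hp' := (Finset.mem_filter.1 hp).2
    -- A prime above D has only the divisor 1 in the support, where the weight is 1, so its square
    -- counts it exactly once.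
    have : K.filter (· ∣ p) = {1} := by
      ext d
      simp only [Finset.mem_filter, Finset.mem_singleton]
      constructor
      · rintro ⟨h, h'⟩
        rcases (Nat.dvd_prime hp'.1).1 h' with h2 | h2
        · exact h2
        · have := (mem_sieveSupport.1 h).1.2
          omega
      · rintro rfl
        exact ⟨one_mem_sieveSupport hD, one_dvd _⟩
    rw [this, Finset.sum_singleton, hw, sieveWeight_one hD]
    norm_num
  have h2 : ∑ x ∈ S, (∑ d ∈ K.filter (· ∣ x), w d) ^ 2
      = ∑ d ∈ K, ∑ e ∈ K, w d * w e * ((S.filter (d.lcm e ∣ ·)).card : ℝ) := by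
    have : ∀ x ∈ S, (∑ d ∈ K.filter (· ∣ x), w d) ^ 2
        = ∑ d ∈ K, ∑ e ∈ K, if d.lcm e ∣ x then w d * w e else 0 := by
      intro x _
      rw [sq, Finset.sum_filter, Finset.sum_mul_sum]
      refine Finset.sum_congr rfl fun d _ => Finset.sum_congr rfl fun e _ => ?_
      by_cases hd : d ∣ x <;> by_cases he : e ∣ x <;> simp [hd, he, Nat.lcm_dvd_iff]
    rw [Finset.sum_congr rfl this, Finset.sum_comm]
    refine Finset.sum_congr rfl fun d _ => ?_
    rw [Finset.sum_comm]
    refine Finset.sum_congr rfl fun e _ => ?_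
    rw [← Finset.sum_filter, Finset.sum_const, nsmul_eq_mul, mul_comm]
  have h3 : ∀ d ∈ K, ∀ e ∈ K, w d * w e * ((S.filter (d.lcm e ∣ ·)).card : ℝ)
      ≤ X * (w d * w e / (d.lcm e : ℝ)) + (D : ℝ) ^ 2 := by
    intro d hd e he
    rw [hK, mem_sieveSupport] at hd he
    have h4 := hS (d.lcm e) (Nat.lcm_pos hd.1.1 he.1.1)
      ((Nat.Coprime.mul_left hd.2.2 he.2.2).coprime_dvd_left (Nat.lcm_dvd_mul d e))
    have hwd : |w d| ≤ D := (abs_sieveWeight_le hD d).trans (by exact_mod_cast hd.1.2)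
    have hwe : |w e| ≤ D := (abs_sieveWeight_le hD e).trans (by exact_mod_cast he.1.2)
    have h5 : |w d * w e * (((S.filter (d.lcm e ∣ ·)).card : ℝ) - X / (d.lcm e : ℝ))|
        ≤ (D : ℝ) ^ 2 := by
      rw [abs_mul, abs_mul]
      calc |w d| * |w e| * |((S.filter (d.lcm e ∣ ·)).card : ℝ) - X / (d.lcm e : ℝ)|
          ≤ D * D * 1 := by gcongr
        _ = _ := by ring
    have h6 := (le_abs_self _).trans h5
    calc _ = X * (w d * w e / (d.lcm e : ℝ)) +
        w d * w e * (((S.filter (d.lcm e ∣ ·)).card : ℝ) - X / (d.lcm e : ℝ)) := by ring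
      _ ≤ _ := by gcongr
  rw [h2] at h1
  refine h1.trans ((Finset.sum_le_sum fun d hd => Finset.sum_le_sum fun e he =>
    h3 d hd e he).trans ?_)
  simp only [Finset.sum_add_distrib, Finset.sum_const, nsmul_eq_mul, ← Finset.mul_sum]
  have hcard : (K.card : ℝ) ≤ D := by
    have : K.card ≤ (Finset.Icc 1 D).card := Finset.card_filter_le _ _
    rw [Nat.card_Icc] at this
    exact_mod_cast this
  have h7 := sum_sieveWeight_mul_div_lcm_le (m := m) hD
  have h8 : (K.card : ℝ) * (K.card * (D : ℝ) ^ 2) ≤ D ^ 4 := by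
    calc (K.card : ℝ) * (K.card * (D : ℝ) ^ 2) ≤ D * (D * D ^ 2) := by gcongr
      _ = _ := by ring
  gcongr

end SelbergSieve

/-! ### Primes in arithmetic progressions to large moduli. -/

section BrunTitchmarsh

/-- `σ(m)/m`, the sum of the reciprocals of the divisors. -/
noncomputable def abundancy (m : ℕ) : ℝ := ∑ d ∈ m.divisors, (1 / d : ℝ)

theorem abundancy_nonneg (m : ℕ) : 0 ≤ abundancy m := Finset.sum_nonneg fun _ _ => by positivity

theorem one_le_abundancy {m : ℕ} (hm : 0 < m) : 1 ≤ abundancy m := by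
  have := Finset.single_le_sum (f := fun d : ℕ => (1 / d : ℝ)) (s := m.divisors)
    (fun _ _ => by positivity) (Nat.one_mem_divisors.2 hm.ne')
  rwa [Nat.cast_one, div_one] at this

theorem abs_card_filter_modEq_sub_le {m : ℕ} (hm : 0 < m) (n a : ℕ) :
    |((((Finset.Ioc 0 n).filter (· ≡ a [MOD m])).card : ℕ) : ℝ) - n / m| ≤ 1 := by
  have h := Nat.Ioc_filter_modEq_card 0 n hm a
  have h1 : ⌊((n : ℚ) - a) / m⌋ - ⌊(((0 : ℕ) : ℚ) - a) / m⌋ ≥ 0 := by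
    rw [ge_iff_le, sub_nonneg]
    apply Int.floor_le_floor
    have : (0 : ℚ) < m := by positivity
    gcongr
    simp
  rw [max_eq_left h1] at h
  have h2 : |((((Finset.Ioc 0 n).filter (· ≡ a [MOD m])).card : ℤ) : ℚ) - n / m| ≤ 1 := by
    rw [h, abs_le]
    have e : ((n : ℚ) - a) / m - (((0 : ℕ) : ℚ) - a) / m = n / m := by push_cast; ring
    have a1 := Int.floor_le (((n : ℚ) - a) / m)
    have a2 := Int.lt_floor_add_one (((n : ℚ) - a) / m)
    have a3 := Int.floor_le ((((0 : ℕ) : ℚ) - a) / m)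
    have a4 := Int.lt_floor_add_one ((((0 : ℕ) : ℚ) - a) / m)
    push_cast at *
    constructor <;> linarith
  have h3 : ((|((((Finset.Ioc 0 n).filter (· ≡ a [MOD m])).card : ℤ) : ℚ) - n / m| : ℚ) : ℝ)
      ≤ ((1 : ℚ) : ℝ) := by exact_mod_cast h2
  push_cast at h3
  exact h3

theorem abs_card_filter_modEq_dvd_sub_le {m d : ℕ} (hm : 0 < m) (hd : 0 < d) (h : d.Coprime m)
    (n a : ℕ) :
    |(((((Finset.Ioc 0 n).filter (· ≡ a [MOD m])).filter (d ∣ ·)).card : ℕ) : ℝ)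
      - (n / m : ℝ) / d| ≤ 1 := by
  obtain ⟨b, hb1, hb2⟩ := Nat.chineseRemainder h 0 a
  have : ((Finset.Ioc 0 n).filter (· ≡ a [MOD m])).filter (d ∣ ·)
      = (Finset.Ioc 0 n).filter (· ≡ b [MOD d * m]) := by
    ext x
    simp only [Finset.mem_filter, ← Nat.modEq_and_modEq_iff_modEq_mul h]
    constructor
    · rintro ⟨⟨h0, h1⟩, h2⟩
      exact ⟨h0, ((Nat.modEq_zero_iff_dvd.2 h2).trans hb1.symm), h1.trans hb2.symm⟩
    · rintro ⟨h0, h1, h2⟩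
      exact ⟨⟨h0, h2.trans hb2⟩, Nat.modEq_zero_iff_dvd.1 (h1.trans hb1)⟩
  rw [this]
  have h2 := abs_card_filter_modEq_sub_le (Nat.mul_pos hd hm) n b
  rwa [show (n / m : ℝ) / d = n / (d * m : ℕ) by push_cast; rw [div_div, mul_comm]]

/-- Every n ≤ D factors as l²gk with g ∣ m and k squarefree and coprime to m, and ∑ 1/l² ≤ 2. This
bounds the sieve mass below by log D / (2 · abundancy). -/
theorem sum_one_div_Icc_le (m D : ℕ) (hm : 0 < m) :
    ∑ n ∈ Finset.Icc 1 D, (1 / n : ℝ) ≤ 2 * abundancy m * sieveMass m D := by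
  have key : ∀ n : ℕ, ∃ t : ℕ × ℕ × ℕ, n ∈ Finset.Icc 1 D →
      t ∈ Finset.Icc 1 D ×ˢ m.divisors ×ˢ sieveSupport m D ∧ t.1 ^ 2 * (t.2.1 * t.2.2) = n := by
    intro n
    by_cases hn : n ∈ Finset.Icc 1 D
    · rw [Finset.mem_Icc] at hn
      obtain ⟨a, b, ha, hb, hab, hsq⟩ := Nat.sq_mul_squarefree_of_pos hn.1
      -- Here a is the squarefree part of n; being squarefree, it becomes coprime to m once gcd(a,
      -- m) is divided out.
      refine ⟨(b, a.gcd m, a / a.gcd m), fun _ => ⟨?_, ?_⟩⟩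
      · have hg : a.gcd m ∣ a := Nat.gcd_dvd_left a m
        have hbn : b ≤ n := by
          rw [← hab]; nlinarith
        have han : a ≤ n := by
          rw [← hab]; exact Nat.le_mul_of_pos_left a (by positivity)
        simp only [Finset.mem_product, Finset.mem_Icc, Nat.mem_divisors, mem_sieveSupport]
        refine ⟨⟨hb, hbn.trans hn.2⟩, ⟨Nat.gcd_dvd_right a m, hm.ne'⟩, ⟨?_, ?_⟩, ?_, ?_⟩
        · exact Nat.div_pos (Nat.le_of_dvd ha hg) (Nat.gcd_pos_of_pos_left m ha)
        · exact (Nat.div_le_self _ _).trans (han.trans hn.2)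
        · exact hsq.squarefree_of_dvd (Nat.div_dvd_of_dvd hg)
        · apply Nat.coprime_of_dvd
          intro q hq hqa hqm
          have h1 : q ∣ a.gcd m := Nat.dvd_gcd (hqa.trans (Nat.div_dvd_of_dvd hg)) hqm
          have h2 : q * q ∣ a := by
            rw [← Nat.mul_div_cancel' hg]
            exact mul_dvd_mul h1 hqa
          exact hq.not_isUnit (hsq q h2)
      · dsimp only
        rw [Nat.mul_div_cancel' (Nat.gcd_dvd_left a m), hab]
    · exact ⟨(0, 0, 0), fun h => absurd h hn⟩
  choose e he using key
  let g : ℕ × ℕ × ℕ → ℝ := fun t => 1 / (t.1 : ℝ) ^ 2 * (1 / t.2.1 * (1 / t.2.2))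
  have h1 : ∑ n ∈ Finset.Icc 1 D, (1 / n : ℝ) = ∑ t ∈ (Finset.Icc 1 D).image e, g t := by
    rw [Finset.sum_image]
    · refine Finset.sum_congr rfl fun n hn => ?_
      have := (he n hn).2
      simp only [g]
      conv_lhs => rw [← this]
      push_cast
      simp only [one_div, mul_inv]
    · intro x hx y hy h
      rw [← (he x hx).2, ← (he y hy).2, h]
  have h2 : ∑ t ∈ (Finset.Icc 1 D).image e, g t
      ≤ ∑ t ∈ Finset.Icc 1 D ×ˢ m.divisors ×ˢ sieveSupport m D, g t := by
    refine Finset.sum_le_sum_of_subset_of_nonneg ?_ fun _ _ _ => by positivity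
    intro t ht
    obtain ⟨n, hn, rfl⟩ := Finset.mem_image.1 ht
    exact (he n hn).1
  have h3 : ∑ t ∈ Finset.Icc 1 D ×ˢ m.divisors ×ˢ sieveSupport m D, g t
      = (∑ l ∈ Finset.Icc 1 D, 1 / (l : ℝ) ^ 2) * (abundancy m * sieveMass m D) := by
    rw [abundancy, sieveMass, Finset.sum_mul_sum, Finset.sum_mul_sum, Finset.sum_product]
    refine Finset.sum_congr rfl fun l _ => ?_
    rw [Finset.sum_product]
    simp only [g, Finset.mul_sum]
  have h4 : ∑ l ∈ Finset.Icc 1 D, 1 / (l : ℝ) ^ 2 ≤ 2 := by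
    rcases Nat.eq_zero_or_pos D with rfl | hD
    · simp
    rw [← Finset.add_sum_Ioc_eq_sum_Icc hD]
    have := sum_Ioc_inv_sq_le_sub (α := ℝ) (k := 1) (n := D) one_ne_zero hD
    simp only [one_div]
    have h5 : (0 : ℝ) ≤ ((D : ℝ))⁻¹ := by positivity
    norm_num at this ⊢
    linarith
  rw [h1]
  refine h2.trans (h3.trans_le ?_)
  rw [mul_assoc]
  refine mul_le_mul_of_nonneg_right h4 (mul_nonneg (abundancy_nonneg m) ?_)
  exact Finset.sum_nonneg fun _ _ => by positivity

theorem card_primes_modEq_le {m D : ℕ} (hm : 0 < m) (hD : 2 ≤ D) (n a : ℕ) :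
    ((((Finset.Ioc 0 n).filter fun p => p.Prime ∧ p ≡ a [MOD m]).card : ℕ) : ℝ)
      ≤ 2 * (n / m) * abundancy m / Real.log D + 2 * (D : ℝ) ^ 4 := by
  set S := (Finset.Ioc 0 n).filter (· ≡ a [MOD m]) with hS
  have h1 := card_primes_le_of_equidistributed (m := m) (D := D) (by omega) S
    (X := (n / m : ℝ)) (by positivity)
    (fun d hd hdm => abs_card_filter_modEq_dvd_sub_le hm hd hdm n a)
  have hG := sieveMass_pos (m := m) (D := D) (by omega)
  have hlog : 0 < Real.log D := Real.log_pos (by exact_mod_cast hD)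
  have h2 : Real.log D ≤ 2 * abundancy m * sieveMass m D := by
    refine le_trans ?_ (sum_one_div_Icc_le m D hm)
    have h3 := log_add_one_le_harmonic D
    rw [harmonic_eq_sum_Icc] at h3
    push_cast at h3
    simp only [one_div]
    refine le_trans (Real.log_le_log (by positivity) (by linarith)) h3
  have h4 : 1 / sieveMass m D ≤ 2 * abundancy m / Real.log D := by
    rw [div_le_div_iff₀ hG hlog]
    linarith
  have h5 : ((Finset.Ioc 0 n).filter fun p => p.Prime ∧ p ≡ a [MOD m]).card
      ≤ (S.filter fun p => p.Prime ∧ D < p).card + D := by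
    have : (Finset.Ioc 0 n).filter (fun p => p.Prime ∧ p ≡ a [MOD m])
        ⊆ (S.filter fun p => p.Prime ∧ D < p) ∪ Finset.Ioc 0 D := by
      intro p hp
      simp only [hS, Finset.mem_filter, Finset.mem_union, Finset.mem_Ioc] at hp ⊢
      by_cases h : D < p
      · exact Or.inl ⟨⟨hp.1, hp.2.2⟩, hp.2.1, h⟩
      · exact Or.inr ⟨hp.1.1, by omega⟩
    refine (Finset.card_le_card this).trans ((Finset.card_union_le _ _).trans ?_)
    simp
  have h6 : ((((Finset.Ioc 0 n).filter fun p => p.Prime ∧ p ≡ a [MOD m]).card : ℕ) : ℝ)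
      ≤ ((S.filter fun p => p.Prime ∧ D < p).card : ℝ) + D := by exact_mod_cast h5
  have h7 : (D : ℝ) ≤ (D : ℝ) ^ 4 := le_self_pow₀ (by exact_mod_cast (by omega : 1 ≤ D)) (by norm_num)
  have h8 : (n / m : ℝ) * (1 / sieveMass m D) ≤ (n / m) * (2 * abundancy m / Real.log D) := by
    gcongr
  calc _ ≤ _ := h6
    _ ≤ (n / m) * (2 * abundancy m / Real.log D) + (D : ℝ) ^ 4 + (D : ℝ) ^ 4 := by linarith
    _ = _ := by ring

/-- A Brun–Titchmarsh inequality with an unspecified constant. -/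
theorem eventually_card_primes_modEq_le :
    ∀ᶠ n : ℕ in atTop, ∀ m a : ℕ, 0 < m → m ^ 3 ≤ n ^ 2 →
      ((((Finset.Ioc 0 n).filter fun p => p.Prime ∧ p ≡ a [MOD m]).card : ℕ) : ℝ)
        ≤ 65 * (n / Real.log n) * (abundancy m / m) := by
  have hpow : Tendsto (fun n : ℕ => (n : ℝ) ^ ((1 : ℝ) / 32)) atTop atTop :=
    (tendsto_rpow_atTop (by norm_num)).comp tendsto_natCast_atTop_atTop
  have hlo : ∀ᶠ n : ℕ in atTop, 2 * Real.log n ≤ (n : ℝ) ^ ((1 : ℝ) / 12) := by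
    have := (isLittleO_log_rpow_atTop (r := 1 / 12) (by norm_num)).bound
      (c := 1 / 2) (by norm_num)
    have := tendsto_natCast_atTop_atTop.eventually this
    filter_upwards [this, eventually_ge_atTop 1] with n hn hn1
    have hl : 0 ≤ Real.log n := Real.log_nonneg (by exact_mod_cast hn1)
    rw [Real.norm_of_nonneg hl, Real.norm_of_nonneg (by positivity)] at hn
    linarith
  filter_upwards [hpow.eventually_ge_atTop 2, hlo, eventually_ge_atTop 2] with n h2 hlog hn m a hm hmn
  have hn0 : (0 : ℝ) < n := by positivity
  have hln : 0 < Real.log n := Real.log_pos (by exact_mod_cast hn)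
  -- The sieve error D⁴ ≤ n^{1/4} is negligible against n/m ≥ n^{1/3}, and log D ≥ (log n)/32
  -- accounts for the 64 in the main term.
  set D := ⌊(n : ℝ) ^ ((1 : ℝ) / 16)⌋₊ with hDdef
  have hsq : (n : ℝ) ^ ((1 : ℝ) / 16) = (n : ℝ) ^ ((1 : ℝ) / 32) * (n : ℝ) ^ ((1 : ℝ) / 32) := by
    rw [← Real.rpow_add hn0]; norm_num
  have hDge : (n : ℝ) ^ ((1 : ℝ) / 32) ≤ D := by
    have := Nat.lt_floor_add_one ((n : ℝ) ^ ((1 : ℝ) / 16))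
    rw [← hDdef, hsq] at this
    nlinarith
  have hD2 : 2 ≤ D := by exact_mod_cast h2.trans hDge
  have hDlog : Real.log n / 32 ≤ Real.log D := by
    have := Real.log_le_log (by positivity) hDge
    rw [Real.log_rpow hn0] at this
    linarith
  have hD4 : (D : ℝ) ^ 4 ≤ (n : ℝ) ^ ((1 : ℝ) / 4) := by
    have h1 : (D : ℝ) ≤ (n : ℝ) ^ ((1 : ℝ) / 16) := Nat.floor_le (by positivity)
    calc (D : ℝ) ^ 4 ≤ ((n : ℝ) ^ ((1 : ℝ) / 16)) ^ 4 := by gcongr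
      _ = _ := by rw [← Real.rpow_natCast, ← Real.rpow_mul hn0.le]; norm_num
  have hm1 : (m : ℝ) ≤ (n : ℝ) ^ ((2 : ℝ) / 3) := by
    have h1 : (m : ℝ) ^ (3 : ℕ) ≤ (n : ℝ) ^ (2 : ℕ) := by exact_mod_cast hmn
    have h3 : ((n : ℝ) ^ ((2 : ℝ) / 3)) ^ (3 : ℕ) = (n : ℝ) ^ (2 : ℕ) := by
      rw [← Real.rpow_natCast, ← Real.rpow_mul hn0.le, ← Real.rpow_natCast]; norm_num
    rw [← h3] at h1
    exact le_of_pow_le_pow_left₀ (by norm_num) (by positivity) h1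
  have hm0 : (0 : ℝ) < m := by positivity
  have habund := one_le_abundancy hm
  have hmain := card_primes_modEq_le hm hD2 n a
  have e1 : 2 * (n / m : ℝ) * abundancy m / Real.log D
      ≤ 64 * (n / Real.log n) * (abundancy m / m) := by
    calc 2 * (n / m : ℝ) * abundancy m / Real.log D
        ≤ 2 * (n / m : ℝ) * abundancy m / (Real.log n / 32) := by gcongr
      _ = _ := by field_simp; ring
  have e2 : 2 * (D : ℝ) ^ 4 ≤ (n / Real.log n) * (abundancy m / m) := by
    have h5 : (n : ℝ) ^ ((1 : ℝ) / 3) ≤ n / m := by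
      rw [le_div_iff₀ hm0]
      calc (n : ℝ) ^ ((1 : ℝ) / 3) * m ≤ (n : ℝ) ^ ((1 : ℝ) / 3) * (n : ℝ) ^ ((2 : ℝ) / 3) := by
            gcongr
        _ = n := by rw [← Real.rpow_add hn0]; norm_num
    have h6 : (n : ℝ) ^ ((1 : ℝ) / 4) * (n : ℝ) ^ ((1 : ℝ) / 12) = (n : ℝ) ^ ((1 : ℝ) / 3) := by
      rw [← Real.rpow_add hn0]; norm_num
    have h7 : 2 * (D : ℝ) ^ 4 * Real.log n ≤ n / m := by
      calc 2 * (D : ℝ) ^ 4 * Real.log n = (D : ℝ) ^ 4 * (2 * Real.log n) := by ring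
        _ ≤ (n : ℝ) ^ ((1 : ℝ) / 4) * (n : ℝ) ^ ((1 : ℝ) / 12) := by gcongr
        _ ≤ _ := h6.trans_le h5
    calc 2 * (D : ℝ) ^ 4 ≤ (n / m) / Real.log n := by rwa [le_div_iff₀ hln]
      _ = (n / Real.log n) * (1 / m) := by field_simp
      _ ≤ _ := by gcongr
  linarith

end BrunTitchmarsh

/-! ### Turán's inequality and moments of σ(m)/m. -/

section Turan

/-- Number of elements of `Q` dividing `n`. -/
def countDivisorsIn (Q : Finset ℕ) (n : ℕ) : ℕ := (Q.filter (· ∣ n)).card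

theorem countDivisorsIn_cast (Q : Finset ℕ) (n : ℕ) :
    (countDivisorsIn Q n : ℝ) = ∑ q ∈ Q, if q ∣ n then (1 : ℝ) else 0 := by
  rw [countDivisorsIn, Finset.card_filter]
  push_cast
  rfl

theorem sum_indicator_dvd (X d : ℕ) :
    ∑ t ∈ Finset.Ioc 0 X, (if d ∣ t then (1 : ℝ) else 0) = ((X / d : ℕ) : ℝ) := by
  rw [← Nat.Ioc_filter_dvd_card_eq_div, Finset.card_filter]
  push_cast
  rfl

theorem sum_countDivisorsIn_ge (Q : Finset ℕ) (X : ℕ) :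
    X * (∑ q ∈ Q, (1 / q : ℝ)) - Q.card ≤ ∑ t ∈ Finset.Ioc 0 X, (countDivisorsIn Q t : ℝ) := by
  simp only [countDivisorsIn_cast]
  rw [Finset.sum_comm, Finset.mul_sum, Finset.card_eq_sum_ones]
  push_cast
  rw [← Finset.sum_sub_distrib]
  refine Finset.sum_le_sum fun q _ => ?_
  rw [sum_indicator_dvd]
  rcases Nat.eq_zero_or_pos q with rfl | hq
  · simp
  have h1 : X < q * (X / q + 1) := Nat.lt_mul_div_succ X hq
  have h2 : (X : ℝ) < q * ((X / q : ℕ) + 1) := by exact_mod_cast h1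
  have hq' : (0 : ℝ) < q := by positivity
  rw [mul_one_div, sub_le_iff_le_add, div_le_iff₀ hq']
  linarith

theorem sum_countDivisorsIn_sq_le (Q : Finset ℕ) (hQ : ∀ q ∈ Q, q.Prime) (X : ℕ) :
    ∑ t ∈ Finset.Ioc 0 X, (countDivisorsIn Q t : ℝ) ^ 2
      ≤ X * (∑ q ∈ Q, (1 / q : ℝ)) ^ 2 + X * (∑ q ∈ Q, (1 / q : ℝ)) := by
  have h1 : ∀ t ∈ Finset.Ioc 0 X, (countDivisorsIn Q t : ℝ) ^ 2
      = ∑ q ∈ Q, ∑ r ∈ Q, if q.lcm r ∣ t then (1 : ℝ) else 0 := by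
    intro t _
    rw [countDivisorsIn_cast, sq, Finset.sum_mul_sum]
    refine Finset.sum_congr rfl fun q _ => Finset.sum_congr rfl fun r _ => ?_
    by_cases hq : q ∣ t <;> by_cases hr : r ∣ t <;> simp [hq, hr, Nat.lcm_dvd_iff]
  rw [Finset.sum_congr rfl h1, Finset.sum_comm, sq, Finset.sum_mul_sum, Finset.mul_sum,
    Finset.mul_sum, ← Finset.sum_add_distrib]
  refine Finset.sum_le_sum fun q hq => ?_
  rw [Finset.sum_comm, Finset.mul_sum]
  have h2 : ∀ r ∈ Q, ∑ t ∈ Finset.Ioc 0 X, (if q.lcm r ∣ t then (1 : ℝ) else 0)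
      ≤ X * (1 / q * (1 / r)) + if q = r then (X * (1 / q) : ℝ) else 0 := by
    intro r hr
    rw [sum_indicator_dvd]
    refine Nat.cast_div_le.trans ?_
    split_ifs with h
    · subst h
      rw [Nat.lcm_self, mul_one_div (X : ℝ) (q : ℝ)]
      exact le_add_of_nonneg_left (by positivity)
    · rw [((Nat.coprime_primes (hQ q hq) (hQ r hr)).2 h).lcm_eq_mul]
      push_cast
      apply le_of_eq
      field_simp
      ring
  refine (Finset.sum_le_sum h2).trans ?_
  rw [Finset.sum_add_distrib, Finset.sum_ite_eq Q q, if_pos hq]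

/-- Turán's inequality: few integers have markedly fewer prime factors in `Q` than expected. -/
theorem card_few_divisors_le (Q : Finset ℕ) (hQ : ∀ q ∈ Q, q.Prime) (X : ℕ)
    (hE : 0 < ∑ q ∈ Q, (1 / q : ℝ)) :
    ((((Finset.Ioc 0 X).filter fun t =>
        (countDivisorsIn Q t : ℝ) ≤ 9 / 10 * ∑ q ∈ Q, (1 / q : ℝ)).card : ℕ) : ℝ)
      ≤ 100 * (X + 2 * Q.card) / ∑ q ∈ Q, (1 / q : ℝ) := by
  set E := ∑ q ∈ Q, (1 / q : ℝ) with hEdef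
  have h1 := sum_countDivisorsIn_sq_le Q hQ X
  have h2 := sum_countDivisorsIn_ge Q X
  rw [← hEdef] at h1 h2
  -- The terms XE² cancel in the variance, leaving XE and the rounding error of the first moment.
  -- Chebyshev's inequality with deviation E/10 follows.
  have h3 : ∑ t ∈ Finset.Ioc 0 X, ((countDivisorsIn Q t : ℝ) - E) ^ 2
      ≤ (X + 2 * Q.card) * E := by
    have : ∑ t ∈ Finset.Ioc 0 X, ((countDivisorsIn Q t : ℝ) - E) ^ 2
        = ∑ t ∈ Finset.Ioc 0 X, (countDivisorsIn Q t : ℝ) ^ 2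
          - 2 * E * ∑ t ∈ Finset.Ioc 0 X, (countDivisorsIn Q t : ℝ) + X * E ^ 2 := by
      rw [Finset.mul_sum, ← Finset.sum_sub_distrib]
      have : (X : ℝ) * E ^ 2 = ∑ t ∈ Finset.Ioc 0 X, E ^ 2 := by simp
      rw [this, ← Finset.sum_add_distrib]
      exact Finset.sum_congr rfl fun t _ => by ring
    rw [this]
    nlinarith [mul_le_mul_of_nonneg_left h2 hE.le]
  have h4 : ((((Finset.Ioc 0 X).filter fun t => (countDivisorsIn Q t : ℝ) ≤ 9 / 10 * E).card : ℕ)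
      : ℝ) * (E / 10) ^ 2 ≤ ∑ t ∈ Finset.Ioc 0 X, ((countDivisorsIn Q t : ℝ) - E) ^ 2 := by
    rw [← nsmul_eq_mul, ← Finset.sum_const]
    refine le_trans (Finset.sum_le_sum fun t ht => ?_)
      (Finset.sum_le_sum_of_subset_of_nonneg (Finset.filter_subset _ _)
        fun _ _ _ => sq_nonneg _)
    have := (Finset.mem_filter.1 ht).2
    nlinarith
  rw [le_div_iff₀ hE]
  have h5 := h4.trans h3
  refine le_of_mul_le_mul_right ?_ hE
  nlinarith

/-- Expanding the square gives ∑ X/(d e lcm(d,e)), and lcm(d,e) ≥ √(de) separates it into two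
convergent sums of d^{-3/2}. -/
theorem exists_sum_abundancy_sq_le :
    ∃ C : ℝ, 0 < C ∧ ∀ X : ℕ, ∑ m ∈ Finset.Ioc 0 X, abundancy m ^ 2 ≤ C * X := by
  have hs : Summable fun d : ℕ => 1 / (d : ℝ) ^ ((3 : ℝ) / 2) :=
    Real.summable_one_div_nat_rpow.2 (by norm_num)
  set Z := ∑' d : ℕ, 1 / (d : ℝ) ^ ((3 : ℝ) / 2)
  have hZ : 0 ≤ Z := tsum_nonneg fun d => by positivity
  refine ⟨Z ^ 2 + 1, by positivity, fun X => ?_⟩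
  have h0 : ∀ m ∈ Finset.Ioc 0 X, abundancy m
      = ∑ d ∈ Finset.Ioc 0 X, if d ∣ m then (1 / d : ℝ) else 0 := by
    intro m hm
    rw [Finset.mem_Ioc] at hm
    rw [abundancy, ← Finset.sum_filter]
    refine Finset.sum_congr ?_ fun _ _ => rfl
    ext d
    simp only [Nat.mem_divisors, Finset.mem_filter, Finset.mem_Ioc]
    constructor
    · rintro ⟨h, _⟩
      exact ⟨⟨Nat.pos_of_dvd_of_pos h hm.1, (Nat.le_of_dvd hm.1 h).trans hm.2⟩, h⟩
    · rintro ⟨_, h⟩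
      exact ⟨h, hm.1.ne'⟩
  have h1 : ∀ m ∈ Finset.Ioc 0 X, abundancy m ^ 2
      = ∑ d ∈ Finset.Ioc 0 X, ∑ e ∈ Finset.Ioc 0 X,
        (1 / d * (1 / e) : ℝ) * if d.lcm e ∣ m then (1 : ℝ) else 0 := by
    intro m hm
    rw [h0 m hm, sq, Finset.sum_mul_sum]
    refine Finset.sum_congr rfl fun d _ => Finset.sum_congr rfl fun e _ => ?_
    by_cases hd : d ∣ m <;> by_cases he : e ∣ m <;> simp [hd, he, Nat.lcm_dvd_iff]
  rw [Finset.sum_congr rfl h1, Finset.sum_comm]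
  have h2 : ∀ d ∈ Finset.Ioc 0 X, ∑ m ∈ Finset.Ioc 0 X, ∑ e ∈ Finset.Ioc 0 X,
        ((1 / d * (1 / e) : ℝ) * if d.lcm e ∣ m then (1 : ℝ) else 0)
      ≤ ∑ e ∈ Finset.Ioc 0 X, X * (1 / (d : ℝ) ^ ((3 : ℝ) / 2) * (1 / (e : ℝ) ^ ((3 : ℝ) / 2))) := by
    intro d hd
    rw [Finset.sum_comm]
    refine Finset.sum_le_sum fun e he => ?_
    rw [← Finset.mul_sum, sum_indicator_dvd]
    rw [Finset.mem_Ioc] at hd he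
    have hd0 : (0 : ℝ) < d := by exact_mod_cast hd.1
    have he0 : (0 : ℝ) < e := by exact_mod_cast he.1
    have hl0 : (0 : ℝ) < d.lcm e := by exact_mod_cast Nat.lcm_pos hd.1 he.1
    have hlcm : (d : ℝ) ^ ((1 : ℝ) / 2) * (e : ℝ) ^ ((1 : ℝ) / 2) ≤ d.lcm e := by
      rw [← Real.sqrt_eq_rpow, ← Real.sqrt_eq_rpow, ← Real.sqrt_mul hd0.le]
      apply Real.sqrt_le_iff.2 ⟨hl0.le, ?_⟩
      have a1 : (d : ℝ) ≤ d.lcm e := by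
        exact_mod_cast Nat.le_of_dvd (Nat.lcm_pos hd.1 he.1) (Nat.dvd_lcm_left d e)
      have a2 : (e : ℝ) ≤ d.lcm e := by
        exact_mod_cast Nat.le_of_dvd (Nat.lcm_pos hd.1 he.1) (Nat.dvd_lcm_right d e)
      rw [sq]
      exact mul_le_mul a1 a2 he0.le hl0.le
    have e1 : (d : ℝ) ^ ((3 : ℝ) / 2) = d * (d : ℝ) ^ ((1 : ℝ) / 2) := by
      rw [← Real.rpow_one_add' hd0.le (by norm_num)]; norm_num
    have e2 : (e : ℝ) ^ ((3 : ℝ) / 2) = e * (e : ℝ) ^ ((1 : ℝ) / 2) := by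
      rw [← Real.rpow_one_add' he0.le (by norm_num)]; norm_num
    calc (1 / d * (1 / e) : ℝ) * ((X / d.lcm e : ℕ) : ℝ)
        ≤ (1 / d * (1 / e) : ℝ) * (X / (d.lcm e : ℝ)) := by gcongr; exact Nat.cast_div_le
      _ ≤ (1 / d * (1 / e) : ℝ) * (X / ((d : ℝ) ^ ((1 : ℝ) / 2) * (e : ℝ) ^ ((1 : ℝ) / 2))) := by
          gcongr
      _ = _ := by
          rw [e1, e2]
          field_simp
  refine (Finset.sum_le_sum h2).trans ?_
  simp only [← Finset.mul_sum]
  rw [← Finset.sum_mul]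
  have h3 : ∑ d ∈ Finset.Ioc 0 X, 1 / (d : ℝ) ^ ((3 : ℝ) / 2) ≤ Z :=
    hs.sum_le_tsum _ fun _ _ => by positivity
  have h4 : 0 ≤ ∑ d ∈ Finset.Ioc 0 X, 1 / (d : ℝ) ^ ((3 : ℝ) / 2) :=
    Finset.sum_nonneg fun _ _ => by positivity
  have h5 := mul_le_mul h3 h3 h4 hZ
  have hX : (0 : ℝ) ≤ X := by positivity
  nlinarith

/-- Cauchy–Schwarz for the abundancy index over integers with few prime factors in `Q`. -/
theorem exists_sum_abundancy_few_divisors_le :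
    ∃ C : ℝ, 0 < C ∧ ∀ (Q : Finset ℕ), (∀ q ∈ Q, q.Prime) → 0 < ∑ q ∈ Q, (1 / q : ℝ) →
      ∀ X : ℕ, 2 * Q.card ≤ X →
      ∑ m ∈ (Finset.Ioc 0 X).filter (fun t =>
        (countDivisorsIn Q t : ℝ) ≤ 9 / 10 * ∑ q ∈ Q, (1 / q : ℝ)), abundancy m
      ≤ C * X / √(∑ q ∈ Q, (1 / q : ℝ)) := by
  obtain ⟨C, hC, hsum⟩ := exists_sum_abundancy_sq_le
  refine ⟨√(200 * C), by positivity, fun Q hQ hE X hX => ?_⟩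
  set E := ∑ q ∈ Q, (1 / q : ℝ) with hEdef
  set T := (Finset.Ioc 0 X).filter fun t => (countDivisorsIn Q t : ℝ) ≤ 9 / 10 * E
  have h1 : (∑ m ∈ T, abundancy m) ^ 2 ≤ T.card * ∑ m ∈ T, abundancy m ^ 2 :=
    sq_sum_le_card_mul_sum_sq
  have h2 : ∑ m ∈ T, abundancy m ^ 2 ≤ C * X :=
    (Finset.sum_le_sum_of_subset_of_nonneg (Finset.filter_subset _ _)
      fun _ _ _ => sq_nonneg _).trans (hsum X)
  have h3 : (T.card : ℝ) ≤ 200 * X / E := by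
    refine (card_few_divisors_le Q hQ X hE).trans ?_
    have : (2 * Q.card : ℝ) ≤ X := by exact_mod_cast hX
    exact div_le_div_of_nonneg_right (by linarith) hE.le
  rw [le_div_iff₀ (Real.sqrt_pos.2 hE)]
  have h0 : 0 ≤ ∑ m ∈ T, abundancy m := Finset.sum_nonneg fun m _ => abundancy_nonneg m
  apply le_of_sq_le_sq _ (by positivity)
  rw [mul_pow, mul_pow, Real.sq_sqrt hE.le, Real.sq_sqrt (by positivity)]
  calc (∑ m ∈ T, abundancy m) ^ 2 * E ≤ (200 * X / E * (C * X)) * E := by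
        gcongr
        refine h1.trans ?_
        gcongr
    _ = _ := by field_simp

end Turan

/-! ### Primes dividing Fibonacci numbers of small index. -/

section PrimesOfSmallRank

theorem fib_le_two_pow (n : ℕ) : Nat.fib n ≤ 2 ^ n := by
  induction n using Nat.twoStepInduction with
  | zero => simp
  | one => simp
  | more n h1 h2 =>
    rw [Nat.fib_add_two, pow_add]
    rw [pow_succ] at h2
    omega

/-- The product of these primes divides F_t ≤ 2^t, while each of them exceeds √n. -/
theorem card_large_prime_divisors_fib_le {n t : ℕ} (hn : 2 ≤ n) (ht : 0 < t) (P : Finset ℕ)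
    (hP : ∀ p ∈ P, p.Prime ∧ n < p ^ 2 ∧ p ∣ Nat.fib t) :
    (P.card : ℝ) ≤ 2 * t / Real.log n := by
  have h1 : ∏ p ∈ P, p ∣ Nat.fib t :=
    Finset.prod_primes_dvd _ (fun p hp => (hP p hp).1.prime) fun p hp => (hP p hp).2.2
  have h2 : ∏ p ∈ P, p ≤ 2 ^ t :=
    (Nat.le_of_dvd (Nat.fib_pos.2 ht) h1).trans (fib_le_two_pow t)
  have h3 : n ^ P.card ≤ 4 ^ t := by
    calc n ^ P.card = ∏ p ∈ P, n := by rw [Finset.prod_const]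
      _ ≤ ∏ p ∈ P, p ^ 2 := Finset.prod_le_prod' fun p hp => (hP p hp).2.1.le
      _ = (∏ p ∈ P, p) ^ 2 := Finset.prod_pow _ _ _
      _ ≤ (2 ^ t) ^ 2 := Nat.pow_le_pow_left h2 2
      _ = 4 ^ t := by rw [← pow_mul, mul_comm, pow_mul]; norm_num
  have hl : 0 < Real.log n := Real.log_pos (by exact_mod_cast hn)
  have h4 : (P.card : ℝ) * Real.log n ≤ t * Real.log 4 := by
    rw [← Real.log_pow, ← Real.log_pow]
    exact Real.log_le_log (by positivity) (by exact_mod_cast h3)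
  have h5 : Real.log 4 ≤ 2 := by
    rw [show (4 : ℝ) = 2 ^ 2 by norm_num, Real.log_pow]
    have := Real.log_two_lt_d9
    push_cast
    linarith
  rw [le_div_iff₀ hl]
  have : (0 : ℝ) ≤ t := by positivity
  nlinarith

/-- Primes dividing a Fibonacci number whose index lies in a prescribed set. -/
theorem card_primes_dvd_fib_le {n X : ℕ} (hn : 2 ≤ n) (S : Finset ℕ) (hS : S ⊆ Finset.Ioc 0 X) :
    ((((Finset.Ioc 0 n).filter fun p => p.Prime ∧ n < p ^ 2 ∧ ∃ t ∈ S, p ∣ Nat.fib t).card : ℕ)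
      : ℝ) ≤ S.card * (2 * X / Real.log n) := by
  classical
  have h1 : (Finset.Ioc 0 n).filter (fun p => p.Prime ∧ n < p ^ 2 ∧ ∃ t ∈ S, p ∣ Nat.fib t)
      ⊆ S.biUnion fun t => (Finset.Ioc 0 n).filter fun p => p.Prime ∧ n < p ^ 2 ∧ p ∣ Nat.fib t := by
    intro p hp
    simp only [Finset.mem_filter, Finset.mem_biUnion] at hp ⊢
    obtain ⟨h0, h1, h2, t, ht, h3⟩ := hp
    exact ⟨t, ht, h0, h1, h2, h3⟩
  have h2 := (Finset.card_le_card h1).trans Finset.card_biUnion_le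
  have hl : 0 < Real.log n := Real.log_pos (by exact_mod_cast hn)
  calc _ ≤ ((∑ t ∈ S, ((Finset.Ioc 0 n).filter fun p =>
        p.Prime ∧ n < p ^ 2 ∧ p ∣ Nat.fib t).card : ℕ) : ℝ) := by exact_mod_cast h2
    _ ≤ ∑ t ∈ S, 2 * X / Real.log n := by
        push_cast
        refine Finset.sum_le_sum fun t ht => ?_
        have ht' := Finset.mem_Ioc.1 (hS ht)
        refine (card_large_prime_divisors_fib_le hn ht'.1 _ fun p hp =>
          (Finset.mem_filter.1 hp).2).trans ?_
        have : (t : ℝ) ≤ X := by exact_mod_cast ht'.2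
        gcongr
    _ = _ := by rw [Finset.sum_const, nsmul_eq_mul]

/-- The least index of a Fibonacci number divisible by `p` divides `p - 1` or `p + 1`. -/
theorem exists_fib_index_dvd {p k z : ℕ} (hp : p.Prime) (hp7 : 7 ≤ p) (hk : 0 < k) (hkz : k < z)
    (hdvd : p ∣ Nat.fib k) :
    ∃ t, 0 < t ∧ t < z ∧ p ∣ Nat.fib t ∧ (t ∣ p - 1 ∨ t ∣ p + 1) := by
  classical
  have := Fact.mk hp
  have hex : ∃ t, 0 < t ∧ p ∣ Nat.fib t := ⟨k, hk, hdvd⟩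
  obtain ⟨h1, h2⟩ := Nat.find_spec hex
  set t := Nat.find hex
  -- Since gcd(F_t, F_m) = F_{gcd(t,m)}, minimality of t forces gcd(t, m) = t.
  have key : ∀ m, p ∣ Nat.fib m → t ∣ m := by
    intro m hm
    have h3 : p ∣ Nat.fib (t.gcd m) := by
      rw [Nat.fib_gcd]
      exact Nat.dvd_gcd h2 hm
    have h4 : t ≤ t.gcd m := Nat.find_min' hex ⟨Nat.gcd_pos_of_pos_left m h1, h3⟩
    have h5 : t.gcd m = t := le_antisymm (Nat.gcd_le_left m h1) h4
    exact Nat.gcd_eq_left_iff_dvd.1 h5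
  exact ⟨t, h1, (Nat.find_min' hex ⟨hk, hdvd⟩).trans_lt hkz, h2,
    (dvd_fib_pred_or_dvd_fib_succ hp7).imp (key _) (key _)⟩

end PrimesOfSmallRank

/-! ### Prime factors of p - 1 and p + 1. -/

section ShiftedPrimes

/-- For each modulus `m`, the divisibility `m ∣ s p` confines `p` to one residue class. -/
def IsShift (s : ℕ → ℕ) : Prop :=
  ∀ m, 0 < m → ∃ a, ∀ p, 0 < p → m ∣ s p → p ≡ a [MOD m]

theorem isShift_sub_one : IsShift fun p => p - 1 :=
  fun _ _ => ⟨1, fun _ hp h => ((Nat.modEq_iff_dvd' hp).2 h).symm⟩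

theorem isShift_add_one : IsShift fun p => p + 1 := by
  intro m hm
  refine ⟨m - 1, fun p _ h => Nat.ModEq.add_right_cancel' 1 ?_⟩
  rw [Nat.sub_add_cancel hm]
  exact (Nat.modEq_zero_iff_dvd.2 h).trans (Nat.modEq_zero_iff_dvd.2 dvd_rfl).symm

/-- The Brun–Titchmarsh bound at `n` for the primes `p ≤ n` with `m ∣ s p`. -/
def ShiftBound (s : ℕ → ℕ) (n : ℕ) : Prop :=
  ∀ m, 0 < m → m ^ 3 ≤ n ^ 2 →
    ((((Finset.Ioc 0 n).filter fun p => p.Prime ∧ m ∣ s p).card : ℕ) : ℝ)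
      ≤ 65 * (n / Real.log n) * (abundancy m / m)

theorem eventually_shiftBound {s : ℕ → ℕ} (hs : IsShift s) : ∀ᶠ n in atTop, ShiftBound s n := by
  filter_upwards [eventually_card_primes_modEq_le] with n hn m hm hmn
  obtain ⟨a, ha⟩ := hs m hm
  refine le_trans ?_ (hn m a hm hmn)
  have : (Finset.Ioc 0 n).filter (fun p => p.Prime ∧ m ∣ s p)
      ⊆ (Finset.Ioc 0 n).filter fun p => p.Prime ∧ p ≡ a [MOD m] := by
    intro p hp
    simp only [Finset.mem_filter, Finset.mem_Ioc] at hp ⊢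
    exact ⟨hp.1, hp.2.1, ha p hp.1.1 hp.2.2⟩
  exact_mod_cast Finset.card_le_card this

theorem ShiftBound.card_exists_dvd_le {s : ℕ → ℕ} {n : ℕ} (h : ShiftBound s n) (M : Finset ℕ)
    (hM : ∀ m ∈ M, 0 < m ∧ m ^ 3 ≤ n ^ 2) :
    ((((Finset.Ioc 0 n).filter fun p => p.Prime ∧ ∃ m ∈ M, m ∣ s p).card : ℕ) : ℝ)
      ≤ 65 * (n / Real.log n) * ∑ m ∈ M, abundancy m / m := by
  classical
  have h1 : (Finset.Ioc 0 n).filter (fun p => p.Prime ∧ ∃ m ∈ M, m ∣ s p)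
      ⊆ M.biUnion fun m => (Finset.Ioc 0 n).filter fun p => p.Prime ∧ m ∣ s p := by
    intro p hp
    simp only [Finset.mem_filter, Finset.mem_biUnion] at hp ⊢
    obtain ⟨h0, h1, m, hm, h3⟩ := hp
    exact ⟨m, hm, h0, h1, h3⟩
  have h2 := (Finset.card_le_card h1).trans Finset.card_biUnion_le
  calc _ ≤ ((∑ m ∈ M, ((Finset.Ioc 0 n).filter fun p => p.Prime ∧ m ∣ s p).card : ℕ) : ℝ) := by
        exact_mod_cast h2
    _ ≤ _ := by
        push_cast
        rw [Finset.mul_sum]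
        exact Finset.sum_le_sum fun m hm => h m (hM m hm).1 (hM m hm).2

theorem abundancy_mul_le (a b : ℕ) : abundancy (a * b) ≤ abundancy a * abundancy b := by
  classical
  rw [abundancy, abundancy, abundancy, Finset.sum_mul_sum, ← Finset.sum_product', Nat.divisors_mul,
    Finset.mul_def]
  refine (Finset.sum_image_le_of_nonneg (g := fun x : ℕ × ℕ => x.1 * x.2)
    (f := fun d : ℕ => (1 / d : ℝ)) fun _ _ => by positivity).trans (le_of_eq ?_)
  refine Finset.sum_congr rfl fun x _ => ?_
  push_cast
  rw [one_div_mul_one_div]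

theorem abundancy_prime {q : ℕ} (hq : q.Prime) : abundancy q = 1 + 1 / q := by
  rw [abundancy, hq.sum_divisors, Nat.cast_one, div_one, add_comm]

theorem abundancy_prod_div_le (D : Finset ℕ) (hD : ∀ q ∈ D, q.Prime) :
    abundancy (∏ q ∈ D, q) / ((∏ q ∈ D, q : ℕ) : ℝ) ≤ ∏ q ∈ D, ((1 + 1 / q : ℝ) / q) := by
  classical
  induction D using Finset.induction_on with
  | empty => simp [abundancy]
  | insert q D hq ih =>
    rw [Finset.prod_insert hq, Finset.prod_insert hq]
    have h1 := ih fun r hr => hD r (Finset.mem_insert_of_mem hr)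
    have h2 := abundancy_mul_le q (∏ r ∈ D, r)
    rw [abundancy_prime (hD q (Finset.mem_insert_self _ _))] at h2
    calc abundancy (q * ∏ r ∈ D, r) / ((q * ∏ r ∈ D, r : ℕ) : ℝ)
        ≤ ((1 + 1 / q) * abundancy (∏ r ∈ D, r)) / ((q * ∏ r ∈ D, r : ℕ) : ℝ) := by gcongr
      _ = ((1 + 1 / q : ℝ) / q) * (abundancy (∏ r ∈ D, r) / ((∏ r ∈ D, r : ℕ) : ℝ)) := by
          rw [Nat.cast_mul, mul_div_mul_comm]
      _ ≤ _ := by gcongr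

/-- Both sides count the sets of primes of Q all dividing x, which makes the exponential moment
accessible to Brun–Titchmarsh. -/
theorem two_pow_countDivisorsIn (Q : Finset ℕ) (hQ : ∀ q ∈ Q, q.Prime) (x : ℕ) :
    (2 : ℝ) ^ countDivisorsIn Q x
      = ∑ D ∈ Q.powerset, if (∏ q ∈ D, q) ∣ x then (1 : ℝ) else 0 := by
  have h1 : (Q.filter (· ∣ x)).powerset = Q.powerset.filter fun D => (∏ q ∈ D, q) ∣ x := by
    ext D
    simp only [Finset.mem_powerset, Finset.mem_filter]
    constructor
    · intro h
      have hDQ : D ⊆ Q := h.trans (Finset.filter_subset _ _)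
      exact ⟨hDQ, Finset.prod_primes_dvd _ (fun q hq => (hQ q (hDQ hq)).prime)
        fun q hq => (Finset.mem_filter.1 (h hq)).2⟩
    · rintro ⟨h, hd⟩ q hq
      exact Finset.mem_filter.2 ⟨h hq, (Finset.dvd_prod_of_mem _ hq).trans hd⟩
  rw [← Finset.sum_filter, ← h1, Finset.sum_const, Finset.card_powerset, countDivisorsIn]
  simp

/-- Exponential moment of the number of prime factors in `Q` of shifted primes. -/
theorem ShiftBound.sum_two_pow_le {s : ℕ → ℕ} {n : ℕ} (h : ShiftBound s n) (Q : Finset ℕ)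
    (hQ : ∀ q ∈ Q, q.Prime) (hn : 1 ≤ n) (hQn : (∏ q ∈ Q, q) ^ 3 ≤ n ^ 2) :
    ∑ p ∈ (Finset.Ioc 0 n).filter Nat.Prime, (2 : ℝ) ^ countDivisorsIn Q (s p)
      ≤ 65 * (n / Real.log n) * Real.exp (∑ q ∈ Q, (1 / q : ℝ) + ∑ q ∈ Q, 1 / (q : ℝ) ^ 2) := by
  simp only [two_pow_countDivisorsIn Q hQ]
  rw [Finset.sum_comm]
  have hB : 0 ≤ 65 * (n / Real.log n) :=
    mul_nonneg (by norm_num) (div_nonneg (by positivity) (Real.log_nonneg (by exact_mod_cast hn)))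
  have h1 : ∀ D ∈ Q.powerset, ∑ p ∈ (Finset.Ioc 0 n).filter Nat.Prime,
      (if (∏ q ∈ D, q) ∣ s p then (1 : ℝ) else 0)
      ≤ 65 * (n / Real.log n) * ∏ q ∈ D, ((1 + 1 / q : ℝ) / q) := by
    intro D hD
    rw [Finset.mem_powerset] at hD
    have hpos : 0 < ∏ q ∈ D, q := Finset.prod_pos fun q hq => (hQ q (hD hq)).pos
    have hle : ∏ q ∈ D, q ≤ ∏ q ∈ Q, q :=
      Finset.prod_le_prod_of_subset_of_one_le' hD fun q hq _ => (hQ q hq).one_le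
    have := h _ hpos ((Nat.pow_le_pow_left hle 3).trans hQn)
    rw [← Finset.sum_filter, Finset.filter_filter, Finset.sum_const, nsmul_eq_mul, mul_one]
    exact this.trans (mul_le_mul_of_nonneg_left
      (abundancy_prod_div_le D fun q hq => hQ q (hD hq)) hB)
  refine (Finset.sum_le_sum h1).trans ?_
  -- The sum over subsets of Q is an Euler product, bounded factor by factor through 1 + x ≤ eˣ.
  rw [← Finset.mul_sum, ← Finset.prod_one_add, ← Finset.sum_add_distrib, Real.exp_sum]
  refine mul_le_mul_of_nonneg_left (Finset.prod_le_prod (fun _ _ => by positivity) fun q hq => ?_) hB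
  have hq0 : (q : ℝ) ≠ 0 := by exact_mod_cast (hQ q hq).ne_zero
  have : 1 + (1 + 1 / q : ℝ) / q = (1 / q + 1 / (q : ℝ) ^ 2) + 1 := by field_simp; ring
  rw [this]
  exact Real.add_one_le_exp _

/-- Few primes `p ≤ n` are such that `s p` has many prime factors in `Q`. -/
theorem ShiftBound.card_many_divisors_le {s : ℕ → ℕ} {n : ℕ} (h : ShiftBound s n) (Q : Finset ℕ)
    (hQ : ∀ q ∈ Q, q.Prime) (hn : 1 ≤ n) (hQn : (∏ q ∈ Q, q) ^ 3 ≤ n ^ 2)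
    (hE : 0 < ∑ q ∈ Q, (1 / q : ℝ)) (hQ2 : ∑ q ∈ Q, 1 / (q : ℝ) ^ 2 ≤ 1) :
    ((((Finset.Ioc 0 n).filter fun p => p.Prime ∧
        9 / 5 * ∑ q ∈ Q, (1 / q : ℝ) ≤ countDivisorsIn Q (s p)).card : ℕ) : ℝ)
      ≤ (n / Real.log n) * (975 / ∑ q ∈ Q, (1 / q : ℝ)) := by
  have h1 := h.sum_two_pow_le Q hQ hn hQn
  set E := ∑ q ∈ Q, (1 / q : ℝ)
  have hB : 0 ≤ n / Real.log n :=
    div_nonneg (by positivity) (Real.log_nonneg (by exact_mod_cast hn))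
  set P := (Finset.Ioc 0 n).filter fun p => p.Prime ∧ 9 / 5 * E ≤ countDivisorsIn Q (s p)
  -- Since (9/5) log 2 > 6/5, each prime of P contributes at least e^{6E/5}, against a total of
  -- order e^E; the saving e^{-E/5} is then weakened to 5/E.
  have h2 : (P.card : ℝ) * Real.exp (6 / 5 * E)
      ≤ ∑ p ∈ (Finset.Ioc 0 n).filter Nat.Prime, (2 : ℝ) ^ countDivisorsIn Q (s p) := by
    rw [← nsmul_eq_mul, ← Finset.sum_const]
    have hsub : P ⊆ (Finset.Ioc 0 n).filter Nat.Prime := by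
      intro p hp
      simp only [P, Finset.mem_filter] at hp ⊢
      exact ⟨hp.1, hp.2.1⟩
    refine le_trans (Finset.sum_le_sum fun p hp => ?_)
      (Finset.sum_le_sum_of_subset_of_nonneg hsub fun _ _ _ => by positivity)
    have hp' := (Finset.mem_filter.1 hp).2.2
    rw [← Real.rpow_natCast, Real.rpow_def_of_pos (by norm_num)]
    apply Real.exp_le_exp.2
    have hl := Real.log_two_gt_d9
    nlinarith
  have h3 : Real.exp (E + ∑ q ∈ Q, 1 / (q : ℝ) ^ 2) ≤ Real.exp (6 / 5 * E) * (15 / E) := by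
    have e1 : Real.exp (E + ∑ q ∈ Q, 1 / (q : ℝ) ^ 2)
        ≤ Real.exp 1 * Real.exp (6 / 5 * E) * Real.exp (-(E / 5)) := by
      rw [← Real.exp_add, ← Real.exp_add]
      exact Real.exp_le_exp.2 (by linarith)
    have e2 : Real.exp (-(E / 5)) ≤ 5 / E := by
      rw [Real.exp_neg, ← inv_div E 5]
      exact inv_anti₀ (by positivity) ((by linarith [Real.add_one_le_exp (E / 5)]))
    have e3 : Real.exp 1 ≤ 3 := Real.exp_one_lt_d9.le.trans (by norm_num)
    calc _ ≤ _ := e1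
      _ ≤ 3 * Real.exp (6 / 5 * E) * (5 / E) := by gcongr
      _ = _ := by ring
  have h4 := h2.trans (h1.trans (mul_le_mul_of_nonneg_left h3 (by positivity)))
  refine le_of_mul_le_mul_right (h4.trans (le_of_eq ?_)) (Real.exp_pos (6 / 5 * E))
  ring

theorem sum_one_div_sq_le_of_lt (Q : Finset ℕ) {r : ℕ} (hr : 0 < r) (hQ : ∀ q ∈ Q, r < q) :
    ∑ q ∈ Q, 1 / (q : ℝ) ^ 2 ≤ (1 / r : ℝ) := by
  have hsub : Q ⊆ Finset.Ioc r (max r (Q.sup id)) := by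
    intro q hq
    rw [Finset.mem_Ioc]
    exact ⟨hQ q hq, le_max_of_le_right (Finset.le_sup (f := id) hq)⟩
  refine (Finset.sum_le_sum_of_subset_of_nonneg hsub fun _ _ _ => by positivity).trans ?_
  have := sum_Ioc_inv_sq_le_sub (α := ℝ) hr.ne' (le_max_left r (Q.sup id))
  simp only [one_div]
  refine this.trans (sub_le_self _ (by positivity))

/-- The sum of 1/p over primes diverges, and dropping the primes up to r costs a bounded amount. -/
theorem exists_primes_sum_one_div_ge (r : ℕ) (x : ℝ) :
    ∃ Q : Finset ℕ, (∀ q ∈ Q, q.Prime ∧ r < q) ∧ x ≤ ∑ q ∈ Q, (1 / q : ℝ) := by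
  classical
  by_contra! hcon
  refine not_summable_one_div_on_primes ?_
  refine summable_of_sum_le (c := (∑ q ∈ Finset.range (r + 1), (1 / q : ℝ)) + x)
    (fun i => Set.indicator_nonneg (fun _ _ => by positivity) _) fun u => ?_
  have h1 : ∑ i ∈ u, Set.indicator {p : ℕ | p.Prime} (fun n : ℕ => (1 / n : ℝ)) i
      = ∑ i ∈ u.filter Nat.Prime, (1 / i : ℝ) := by
    rw [Finset.sum_filter]
    exact Finset.sum_congr rfl fun i _ => by simp [Set.indicator_apply]
  rw [h1, ← Finset.sum_filter_add_sum_filter_not (u.filter Nat.Prime) (· ≤ r)]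
  refine add_le_add ?_ (hcon _ ?_).le
  · refine Finset.sum_le_sum_of_subset_of_nonneg ?_ fun _ _ _ => by positivity
    intro q hq
    simp only [Finset.mem_filter, Finset.mem_range] at hq ⊢
    omega
  · intro q hq
    simp only [Finset.mem_filter, not_le] at hq
    exact ⟨hq.1.2, hq.2⟩

/-- An element of Q dividing both t and m would have its square dividing tm. -/
theorem countDivisorsIn_mul_ge (Q : Finset ℕ) {t m : ℕ} (h : ∀ q ∈ Q, ¬ q ^ 2 ∣ t * m) :
    countDivisorsIn Q t + countDivisorsIn Q m ≤ countDivisorsIn Q (t * m) := by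
  classical
  rw [countDivisorsIn, countDivisorsIn, countDivisorsIn, ← Finset.card_union_of_disjoint]
  · refine Finset.card_le_card fun q hq => ?_
    simp only [Finset.mem_union, Finset.mem_filter] at hq ⊢
    rcases hq with ⟨h1, h2⟩ | ⟨h1, h2⟩
    · exact ⟨h1, h2.mul_right m⟩
    · exact ⟨h1, h2.mul_left t⟩
  · rw [Finset.disjoint_left]
    intro q h1 h2
    rw [Finset.mem_filter] at h1 h2
    exact h q h1.1 (by rw [sq]; exact mul_dvd_mul h1.2 h2.2)

end ShiftedPrimes

/-! ### Primes of small rank are rare. -/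

section SmallRank

/-- Primes `p ≤ n` dividing a Fibonacci number of index at most `10√n`. -/
noncomputable def smallRankPrimes (n : ℕ) : Finset ℕ := by
  classical
  exact (Finset.Ioc 0 n).filter fun p =>
    p.Prime ∧ 7 ≤ p ∧ ∃ k, 0 < k ∧ k ^ 2 ≤ 100 * n ∧ p ∣ Nat.fib k

theorem mem_smallRankPrimes {n p : ℕ} : p ∈ smallRankPrimes n ↔ (0 < p ∧ p ≤ n) ∧
    p.Prime ∧ 7 ≤ p ∧ ∃ k, 0 < k ∧ k ^ 2 ≤ 100 * n ∧ p ∣ Nat.fib k := by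
  simp [smallRankPrimes]

theorem tendsto_sqrt_natCast : Tendsto (fun n : ℕ => √(n : ℝ)) atTop atTop :=
  Real.tendsto_sqrt_atTop.comp tendsto_natCast_atTop_atTop

/-- Brun–Titchmarsh with modulus 1. Discarding p ≤ βn ensures later that the cofactor m is at least
of order √n. -/
theorem eventually_card_primes_le_mul {β : ℝ} (hβ : 0 < β) (hβ1 : β < 1) :
    ∀ᶠ n : ℕ in atTop, ((((Finset.Ioc 0 ⌊β * n⌋₊).filter Nat.Prime).card : ℕ) : ℝ)
      ≤ (n / Real.log n) * (130 * β) := by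
  have h1 : Tendsto (fun n : ℕ => ⌊β * n⌋₊) atTop atTop :=
    tendsto_nat_floor_atTop.comp (tendsto_natCast_atTop_atTop.const_mul_atTop hβ)
  filter_upwards [h1.eventually (eventually_shiftBound isShift_sub_one),
    tendsto_sqrt_natCast.eventually_ge_atTop (2 / β), eventually_ge_atTop 2] with n hn hr hn2
  set k := ⌊β * n⌋₊ with hk
  have hr' : 2 ≤ β * √(n : ℝ) := by rw [div_le_iff₀ hβ] at hr; linarith
  have hsq : √(n : ℝ) * √(n : ℝ) = n := Real.mul_self_sqrt (by positivity)
  have hn1 : (1 : ℝ) < n := by exact_mod_cast hn2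
  have hr1 : 1 ≤ √(n : ℝ) := by rw [Real.one_le_sqrt]; exact hn1.le
  have hkle : (k : ℝ) ≤ β * n := Nat.floor_le (by positivity)
  have hkge : √(n : ℝ) ≤ k := by
    have := Nat.lt_floor_add_one (β * n)
    rw [← hk] at this
    nlinarith
  have hk1 : 1 ≤ k := by exact_mod_cast hr1.trans hkge
  have hlog : Real.log n / 2 ≤ Real.log k := by
    rw [← Real.log_sqrt (by positivity)]
    exact Real.log_le_log (by positivity) hkge
  have hln : 0 < Real.log n := Real.log_pos hn1
  have h2 := hn 1 one_pos (by rw [one_pow]; exact Nat.one_le_pow _ _ hk1)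
  have h3 : abundancy 1 = 1 := by simp [abundancy]
  simp only [one_dvd, and_true, h3, Nat.cast_one, div_one, mul_one] at h2
  refine h2.trans ?_
  calc 65 * ((k : ℝ) / Real.log k) ≤ 65 * (β * n / (Real.log n / 2)) := by gcongr
    _ = _ := by field_simp; ring

variable {Q : Finset ℕ}

/-- There are O((δ + 1/E)√n) such indices t by Turán, and each F_t has O(√n / log n) prime factors
above √n. -/
theorem eventually_card_primes_atypical_index_le (hQ : ∀ q ∈ Q, q.Prime)
    (hE : 0 < ∑ q ∈ Q, (1 / q : ℝ)) {δ : ℝ} (hδ : 0 < δ) :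
    ∀ᶠ n : ℕ in atTop, ((((Finset.Ioc 0 n).filter fun p => p.Prime ∧ n < p ^ 2 ∧
      ∃ t ∈ (Finset.Ioc 0 (Nat.sqrt (100 * n))).filter (fun t : ℕ => (t : ℝ) ≤ δ * √(n : ℝ) ∨
        (countDivisorsIn Q t : ℝ) ≤ 9 / 10 * ∑ q ∈ Q, (1 / q : ℝ)), p ∣ Nat.fib t).card : ℕ) : ℝ)
      ≤ (n / Real.log n) * (20 * δ + 22000 / ∑ q ∈ Q, (1 / q : ℝ)) := by
  filter_upwards [tendsto_sqrt_natCast.eventually_ge_atTop (2 * Q.card : ℝ),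
    eventually_ge_atTop 2] with n hr hn2
  set E := ∑ q ∈ Q, (1 / q : ℝ)
  set X := Nat.sqrt (100 * n)
  set S := (Finset.Ioc 0 X).filter (fun t : ℕ => (t : ℝ) ≤ δ * √(n : ℝ) ∨
        (countDivisorsIn Q t : ℝ) ≤ 9 / 10 * E)
  have hsq : √(n : ℝ) * √(n : ℝ) = n := Real.mul_self_sqrt (by positivity)
  have hX : (X : ℝ) ≤ 10 * √(n : ℝ) := by
    have h1 : ((X : ℝ)) ^ 2 ≤ (10 * √(n : ℝ)) ^ 2 := by
      rw [mul_pow, Real.sq_sqrt (by positivity)]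
      have : X ^ 2 ≤ 100 * n := Nat.sqrt_le' _
      calc ((X : ℝ)) ^ 2 ≤ 100 * n := by exact_mod_cast this
        _ = _ := by norm_num
    exact le_of_sq_le_sq h1 (by positivity)
  have hln : 0 < Real.log n := Real.log_pos (by exact_mod_cast hn2)
  have hScard : (S.card : ℝ) ≤ δ * √(n : ℝ) + 100 * (X + 2 * Q.card) / E := by
    have h1 : S ⊆ Finset.Ioc 0 ⌊δ * √(n : ℝ)⌋₊ ∪
        (Finset.Ioc 0 X).filter fun t => (countDivisorsIn Q t : ℝ) ≤ 9 / 10 * E := by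
      intro t ht
      simp only [S, Finset.mem_filter, Finset.mem_union, Finset.mem_Ioc] at ht ⊢
      rcases ht.2 with h | h
      · exact Or.inl ⟨ht.1.1, Nat.le_floor h⟩
      · exact Or.inr ⟨ht.1, h⟩
    have h2 := (Finset.card_le_card h1).trans (Finset.card_union_le _ _)
    rw [Nat.card_Ioc, Nat.sub_zero] at h2
    have h3 : (S.card : ℝ) ≤ (⌊δ * √(n : ℝ)⌋₊ : ℝ) + (((Finset.Ioc 0 X).filter
        fun t => (countDivisorsIn Q t : ℝ) ≤ 9 / 10 * E).card : ℝ) := by exact_mod_cast h2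
    exact h3.trans (add_le_add (Nat.floor_le (by positivity)) (card_few_divisors_le Q hQ X hE))
  refine (card_primes_dvd_fib_le hn2 S (Finset.filter_subset _ _)).trans ?_
  calc (S.card : ℝ) * (2 * X / Real.log n)
      ≤ (δ * √(n : ℝ) + 100 * (10 * √(n : ℝ) + √(n : ℝ)) / E)
        * (2 * (10 * √(n : ℝ)) / Real.log n) := by
        gcongr
        refine hScard.trans ?_
        gcongr
    _ = ((√(n : ℝ) * √(n : ℝ)) / Real.log n) * (20 * δ + 22000 / E) := by ring
    _ = _ := by rw [hsq]

/-- The moduli m have order √n, within the range of Brun–Titchmarsh, so 1/m is comparable to 1/√n.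
The sum of abundancies over atypical m saves a factor √E. -/
theorem exists_eventually_card_primes_atypical_cofactor_le :
    ∃ C : ℝ, 0 < C ∧ ∀ (Q : Finset ℕ), (∀ q ∈ Q, q.Prime) → 0 < ∑ q ∈ Q, (1 / q : ℝ) →
      ∀ β δ : ℝ, 0 < β → 0 < δ → ∀ s : ℕ → ℕ, IsShift s →
      ∀ᶠ n : ℕ in atTop, ((((Finset.Ioc 0 n).filter fun p => p.Prime ∧
        ∃ m ∈ (Finset.Ioc 0 ⌊2 * √(n : ℝ) / δ⌋₊).filter (fun m : ℕ => β * √(n : ℝ) / 20 ≤ m ∧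
          (countDivisorsIn Q m : ℝ) ≤ 9 / 10 * ∑ q ∈ Q, (1 / q : ℝ)), m ∣ s p).card : ℕ) : ℝ)
      ≤ (n / Real.log n) * (C / (β * δ * √(∑ q ∈ Q, (1 / q : ℝ)))) := by
  obtain ⟨C, hC, hsum⟩ := exists_sum_abundancy_few_divisors_le
  refine ⟨2600 * C, by positivity, fun Q hQ hE β δ hβ hδ s hs => ?_⟩
  filter_upwards [eventually_shiftBound hs,
    tendsto_sqrt_natCast.eventually_ge_atTop (8 / δ ^ 3),
    tendsto_sqrt_natCast.eventually_ge_atTop (δ * (2 * Q.card + 1)),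
    eventually_ge_atTop 2] with n hn hr1 hr2 hn2
  set E := ∑ q ∈ Q, (1 / q : ℝ)
  set X := ⌊2 * √(n : ℝ) / δ⌋₊ with hXdef
  set M := (Finset.Ioc 0 X).filter (fun m : ℕ => β * √(n : ℝ) / 20 ≤ m ∧
          (countDivisorsIn Q m : ℝ) ≤ 9 / 10 * E)
  have hr0 : 0 < √(n : ℝ) := Real.sqrt_pos.2 (by positivity)
  have hsq : √(n : ℝ) * √(n : ℝ) = n := Real.mul_self_sqrt (by positivity)
  have hXle : (X : ℝ) ≤ 2 * √(n : ℝ) / δ := Nat.floor_le (by positivity)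
  have hXQ : 2 * Q.card ≤ X := by
    apply Nat.le_floor
    rw [le_div_iff₀ hδ]
    push_cast
    nlinarith
  have hX3 : X ^ 3 ≤ n ^ 2 := by
    have h1 : (X : ℝ) ^ 3 ≤ (n : ℝ) ^ 2 := by
      calc (X : ℝ) ^ 3 ≤ (2 * √(n : ℝ) / δ) ^ 3 := by gcongr
        _ = 8 / δ ^ 3 * (√(n : ℝ)) ^ 3 := by ring
        _ ≤ √(n : ℝ) * (√(n : ℝ)) ^ 3 := by gcongr
        _ = (√(n : ℝ) * √(n : ℝ)) ^ 2 := by ring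
        _ = _ := by rw [hsq]
    exact_mod_cast h1
  have hln : 0 < Real.log n := Real.log_pos (by exact_mod_cast hn2)
  refine (hn.card_exists_dvd_le M fun m hm => ?_).trans ?_
  · have hm' := Finset.mem_Ioc.1 (Finset.mem_filter.1 hm).1
    exact ⟨hm'.1, (Nat.pow_le_pow_left hm'.2 3).trans hX3⟩
  have h1 : ∑ m ∈ M, abundancy m / m ≤ (C * X / √E) * (20 / (β * √(n : ℝ))) := by
    calc ∑ m ∈ M, abundancy m / m ≤ ∑ m ∈ M, abundancy m * (20 / (β * √(n : ℝ))) := by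
          refine Finset.sum_le_sum fun m hm => ?_
          have hm' := (Finset.mem_filter.1 hm).2.1
          rw [div_eq_mul_inv]
          refine mul_le_mul_of_nonneg_left ?_ (abundancy_nonneg m)
          rw [← inv_div (β * √(n : ℝ)) 20]
          exact inv_anti₀ (by positivity) hm'
      _ = (∑ m ∈ M, abundancy m) * (20 / (β * √(n : ℝ))) := (Finset.sum_mul _ _ _).symm
      _ ≤ _ := by
          refine mul_le_mul_of_nonneg_right ?_ (by positivity)
          refine le_trans (Finset.sum_le_sum_of_subset_of_nonneg ?_
            fun m _ _ => abundancy_nonneg m) (hsum Q hQ hE X hXQ)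
          intro m hm
          simp only [M, Finset.mem_filter] at hm ⊢
          exact ⟨hm.1, hm.2.2⟩
  have hE' : 0 < √E := Real.sqrt_pos.2 hE
  calc 65 * ((n : ℝ) / Real.log n) * ∑ m ∈ M, abundancy m / m
      ≤ 65 * ((n : ℝ) / Real.log n) *
        ((C * (2 * √(n : ℝ) / δ) / √E) * (20 / (β * √(n : ℝ)))) := by
        gcongr
        refine h1.trans ?_
        gcongr
    _ = _ := by field_simp; ring

/-- The moduli q² contribute O(∑ 1/q²) over q > r, which is O(1/r) uniformly in Q. -/
theorem eventually_card_primes_sq_dvd_le (hQ : ∀ q ∈ Q, q.Prime) {r : ℕ} (hr : 0 < r)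
    (hQr : ∀ q ∈ Q, r < q) {s : ℕ → ℕ} (hs : IsShift s) :
    ∀ᶠ n : ℕ in atTop, ((((Finset.Ioc 0 n).filter fun p => p.Prime ∧
        ∃ q ∈ Q, q ^ 2 ∣ s p).card : ℕ) : ℝ)
      ≤ (n / Real.log n) * (130 / r) := by
  filter_upwards [eventually_shiftBound hs, eventually_ge_atTop ((∏ q ∈ Q, q) ^ 3),
    eventually_ge_atTop 2] with n hn hQn hn2
  have hln : 0 < Real.log n := Real.log_pos (by exact_mod_cast hn2)
  have himg : ∀ p, (∃ q ∈ Q, q ^ 2 ∣ s p) ↔ ∃ m ∈ Q.image (fun q : ℕ => q ^ 2), m ∣ s p := by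
    simp
  simp only [himg]
  refine (hn.card_exists_dvd_le _ fun m hm => ?_).trans ?_
  · obtain ⟨q, hq, rfl⟩ := Finset.mem_image.1 hm
    refine ⟨pow_pos (hQ q hq).pos 2, ?_⟩
    have h1 : q ≤ ∏ q ∈ Q, q :=
      Finset.single_le_prod' (f := fun q => q) (fun q hq => (hQ q hq).one_le) hq
    calc (q ^ 2) ^ 3 = (q ^ 3) ^ 2 := by ring
      _ ≤ n ^ 2 := Nat.pow_le_pow_left ((Nat.pow_le_pow_left h1 3).trans hQn) 2
  · rw [Finset.sum_image fun x _ y _ h => Nat.pow_left_injective (by norm_num) h]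
    have h1 : ∑ q ∈ Q, abundancy (q ^ 2) / ((q ^ 2 : ℕ) : ℝ) ≤ 2 * ∑ q ∈ Q, 1 / (q : ℝ) ^ 2 := by
      rw [Finset.mul_sum]
      refine Finset.sum_le_sum fun q hq => ?_
      have hq2 : (2 : ℝ) ≤ q := by exact_mod_cast (hQ q hq).two_le
      have h2 : abundancy (q ^ 2) ≤ 2 := by
        rw [abundancy, Nat.sum_divisors_prime_pow (hQ q hq)]
        simp only [Finset.sum_range_succ, Finset.sum_range_zero]
        push_cast
        have a1 : 1 / (q : ℝ) ≤ 1 / 2 := by gcongr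
        have a2 : 1 / (q : ℝ) ^ 2 ≤ 1 / 2 ^ 2 := by gcongr
        norm_num at *
        linarith
      rw [mul_one_div]
      push_cast
      gcongr
    have h2 := sum_one_div_sq_le_of_lt Q hr hQr
    calc 65 * ((n : ℝ) / Real.log n) * ∑ q ∈ Q, abundancy (q ^ 2) / ((q ^ 2 : ℕ) : ℝ)
        ≤ 65 * ((n : ℝ) / Real.log n) * (2 * (1 / r)) := by
          gcongr
          exact h1.trans (by gcongr)
      _ = _ := by ring

theorem eventually_card_primes_many_divisors_le (hQ : ∀ q ∈ Q, q.Prime) {r : ℕ} (hr : 0 < r)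
    (hQr : ∀ q ∈ Q, r < q) (hE : 0 < ∑ q ∈ Q, (1 / q : ℝ)) {s : ℕ → ℕ} (hs : IsShift s) :
    ∀ᶠ n : ℕ in atTop, ((((Finset.Ioc 0 n).filter fun p => p.Prime ∧
        9 / 5 * ∑ q ∈ Q, (1 / q : ℝ) ≤ countDivisorsIn Q (s p)).card : ℕ) : ℝ)
      ≤ (n / Real.log n) * (975 / ∑ q ∈ Q, (1 / q : ℝ)) := by
  filter_upwards [eventually_shiftBound hs, eventually_ge_atTop ((∏ q ∈ Q, q) ^ 3),
    eventually_ge_atTop 1] with n hn hQn hn1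
  refine hn.card_many_divisors_le Q hQ hn1 (hQn.trans (Nat.le_self_pow two_ne_zero n)) hE ?_
  refine (sum_one_div_sq_le_of_lt Q hr hQr).trans ?_
  rw [div_le_one (by positivity)]
  exact_mod_cast hr

/-- A factorisation `s p = t * m` with `t` typical makes `s p` exceptional. -/
theorem exceptional_of_shift_eq_mul {E β δ : ℝ} (hE : E = ∑ q ∈ Q, (1 / q : ℝ)) (hδ : 0 < δ)
    {n x t : ℕ} (hn : 2 ≤ n) (htx : t ∣ x) (hx : 0 < x) (hxn : x ≤ 2 * n)
    (hxβ : β * n / 2 ≤ x) (ht : 0 < t) (htn : t ^ 2 ≤ 100 * n) (htδ : δ * √(n : ℝ) < t)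
    (hty : 9 / 10 * E < countDivisorsIn Q t) :
    (∃ m ∈ (Finset.Ioc 0 ⌊2 * √(n : ℝ) / δ⌋₊).filter (fun m : ℕ => β * √(n : ℝ) / 20 ≤ m ∧
        (countDivisorsIn Q m : ℝ) ≤ 9 / 10 * ∑ q ∈ Q, (1 / q : ℝ)), m ∣ x) ∨
    (∃ q ∈ Q, q ^ 2 ∣ x) ∨
    9 / 5 * ∑ q ∈ Q, (1 / q : ℝ) ≤ countDivisorsIn Q x := by
  rw [← hE]
  obtain ⟨m, rfl⟩ := htx
  have hr0 : 0 < √(n : ℝ) := Real.sqrt_pos.2 (by positivity)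
  have hsq : √(n : ℝ) * √(n : ℝ) = n := Real.mul_self_sqrt (by positivity)
  have hm0 : 0 < m := Nat.pos_of_mul_pos_left hx
  have hm0' : (0 : ℝ) < m := by exact_mod_cast hm0
  have ht0' : (0 : ℝ) < t := by exact_mod_cast ht
  have hxn' : (t : ℝ) * m ≤ 2 * n := by exact_mod_cast hxn
  push_cast at hxβ
  by_cases hm : (countDivisorsIn Q m : ℝ) ≤ 9 / 10 * E
  · left
    refine ⟨m, ?_, dvd_mul_left m t⟩
    rw [Finset.mem_filter, Finset.mem_Ioc]
    -- The upper bound on m comes from tm ≤ 2n and t > δ√n, the lower one from tm ≥ βn/2 and t ≤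
    -- 10√n.
    refine ⟨⟨hm0, Nat.le_floor ?_⟩, ?_, hm⟩
    · rw [le_div_iff₀ hδ]
      refine le_of_mul_le_mul_right ?_ hr0
      nlinarith
    · have ht10 : (t : ℝ) ≤ 10 * √(n : ℝ) := by
        have h1 : (t : ℝ) ^ 2 ≤ 100 * n := by exact_mod_cast htn
        refine le_of_sq_le_sq ?_ (by positivity)
        rw [mul_pow, Real.sq_sqrt (by positivity)]
        linarith
      refine le_of_mul_le_mul_right ?_ hr0
      have h1 := mul_le_mul_of_nonneg_right ht10 hm0'.le
      have h2 : β * √(n : ℝ) / 20 * √(n : ℝ) = β * n / 20 := by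
        linear_combination β / 20 * hsq
      linarith
  · right
    by_cases hsqd : ∃ q ∈ Q, q ^ 2 ∣ t * m
    · left
      obtain ⟨q, hq, hqd⟩ := hsqd
      exact ⟨q, hq, hqd⟩
    · right
      push Not at hsqd hm
      -- With t and m both typical, the two counts above 9E/10 add up to more than 9E/5.
      have h1 := countDivisorsIn_mul_ge Q hsqd
      have h2 : (countDivisorsIn Q t : ℝ) + countDivisorsIn Q m ≤ countDivisorsIn Q (t * m) := by
        exact_mod_cast h1
      linarith

theorem exists_eventually_card_smallRankPrimes_le :
    ∃ C : ℝ, 0 < C ∧ ∀ β δ : ℝ, 0 < β → β < 1 → 0 < δ → ∀ r : ℕ, 0 < r → ∀ Q : Finset ℕ,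
      (∀ q ∈ Q, q.Prime ∧ r < q) → 0 < ∑ q ∈ Q, (1 / q : ℝ) →
      ∀ᶠ n : ℕ in atTop, ((smallRankPrimes n).card : ℝ) ≤ (n / Real.log n) *
        (130 * β + (20 * δ + 22000 / ∑ q ∈ Q, (1 / q : ℝ)) +
          2 * (C / (β * δ * √(∑ q ∈ Q, (1 / q : ℝ))) + 130 / r
            + 975 / ∑ q ∈ Q, (1 / q : ℝ))) := by
  classical
  obtain ⟨C, hC, hcof⟩ := exists_eventually_card_primes_atypical_cofactor_le
  refine ⟨C, hC, fun β δ hβ hβ1 hδ r hr Q hQ hE => ?_⟩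
  have hQp : ∀ q ∈ Q, q.Prime := fun q hq => (hQ q hq).1
  have hQr : ∀ q ∈ Q, r < q := fun q hq => (hQ q hq).2
  filter_upwards [eventually_card_primes_le_mul hβ hβ1,
    eventually_card_primes_atypical_index_le hQp hE hδ,
    hcof Q hQp hE β δ hβ hδ _ isShift_sub_one, hcof Q hQp hE β δ hβ hδ _ isShift_add_one,
    eventually_card_primes_sq_dvd_le hQp hr hQr isShift_sub_one,
    eventually_card_primes_sq_dvd_le hQp hr hQr isShift_add_one,
    eventually_card_primes_many_divisors_le hQp hr hQr hE isShift_sub_one,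
    eventually_card_primes_many_divisors_le hQp hr hQr hE isShift_add_one,
    tendsto_sqrt_natCast.eventually_ge_atTop (2 / β), eventually_ge_atTop 2]
    with n b0 bA bB₁ bB₂ bC₁ bC₂ bD₁ bD₂ hrn hn2
  have hr' : 2 ≤ β * √(n : ℝ) := by rw [div_le_iff₀ hβ] at hrn; linarith
  have hsq : √(n : ℝ) * √(n : ℝ) = n := Real.mul_self_sqrt (by positivity)
  have hn1 : (1 : ℝ) < n := by exact_mod_cast hn2
  have hr1 : 1 ≤ √(n : ℝ) := by rw [Real.one_le_sqrt]; exact hn1.le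
  let W : (ℕ → Prop) → Finset ℕ := fun T => (Finset.Ioc 0 n).filter T
  set TA : ℕ → Prop := fun p => p.Prime ∧ n < p ^ 2 ∧
      ∃ t ∈ (Finset.Ioc 0 (Nat.sqrt (100 * n))).filter (fun t : ℕ => (t : ℝ) ≤ δ * √(n : ℝ) ∨
        (countDivisorsIn Q t : ℝ) ≤ 9 / 10 * ∑ q ∈ Q, (1 / q : ℝ)), p ∣ Nat.fib t
  set TB : (ℕ → ℕ) → ℕ → Prop := fun s p => p.Prime ∧
        ∃ m ∈ (Finset.Ioc 0 ⌊2 * √(n : ℝ) / δ⌋₊).filter (fun m : ℕ => β * √(n : ℝ) / 20 ≤ m ∧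
          (countDivisorsIn Q m : ℝ) ≤ 9 / 10 * ∑ q ∈ Q, (1 / q : ℝ)), m ∣ s p
  set TC : (ℕ → ℕ) → ℕ → Prop := fun s p => p.Prime ∧ ∃ q ∈ Q, q ^ 2 ∣ s p
  set TD : (ℕ → ℕ) → ℕ → Prop := fun s p => p.Prime ∧
        9 / 5 * ∑ q ∈ Q, (1 / q : ℝ) ≤ countDivisorsIn Q (s p)
  -- Either p ≤ βn, or its rank t is atypical, or p ± 1 is exceptional in one of three ways
  -- according to whether t divides p - 1 or p + 1.
  have hcover : smallRankPrimes n ⊆ (Finset.Ioc 0 ⌊β * n⌋₊).filter Nat.Prime ∪ (W TA ∪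
      ((W (TB fun p => p - 1) ∪ (W (TC fun p => p - 1) ∪ W (TD fun p => p - 1))) ∪
       (W (TB fun p => p + 1) ∪ (W (TC fun p => p + 1) ∪ W (TD fun p => p + 1))))) := by
    intro p hp
    rw [mem_smallRankPrimes] at hp
    obtain ⟨⟨hp0, hpn⟩, hprime, hp7, k, hk0, hkn, hkd⟩ := hp
    simp only [Finset.mem_union, W, Finset.mem_filter, Finset.mem_Ioc]
    by_cases hpβ : p ≤ ⌊β * n⌋₊
    · exact Or.inl ⟨⟨hp0, hpβ⟩, hprime⟩
    right
    have hpβ' : β * n < p := Nat.lt_of_floor_lt (not_le.1 hpβ)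
    have hnp : n < p ^ 2 := by
      have h1 : √(n : ℝ) < p := by nlinarith
      have h2 : (n : ℝ) < (p : ℝ) ^ 2 := by nlinarith
      exact_mod_cast h2
    obtain ⟨t, ht0, htz, htd, htp⟩ := exists_fib_index_dvd (z := Nat.sqrt (100 * n) + 1) hprime hp7
      hk0 (Nat.lt_succ_of_le (Nat.le_sqrt'.2 hkn)) hkd
    have htX : t ≤ Nat.sqrt (100 * n) := Nat.lt_succ_iff.1 htz
    by_cases hty : (t : ℝ) ≤ δ * √(n : ℝ) ∨
        (countDivisorsIn Q t : ℝ) ≤ 9 / 10 * ∑ q ∈ Q, (1 / q : ℝ)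
    · left
      exact ⟨⟨hp0, hpn⟩, hprime, hnp, t,
        Finset.mem_filter.2 ⟨Finset.mem_Ioc.2 ⟨ht0, htX⟩, hty⟩, htd⟩
    right
    push Not at hty
    have hβn : 2 ≤ β * n := by nlinarith
    rcases htp with htp | htp
    · left
      have hcast : ((p - 1 : ℕ) : ℝ) = p - 1 := by
        rw [Nat.cast_sub (by omega), Nat.cast_one]
      rcases exceptional_of_shift_eq_mul (β := β) rfl hδ hn2 htp (by omega) (by omega)
        (by rw [hcast]; linarith) ht0 (Nat.le_sqrt'.1 htX) hty.1 hty.2 with h | h | h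
      · exact Or.inl ⟨⟨hp0, hpn⟩, hprime, h⟩
      · exact Or.inr (Or.inl ⟨⟨hp0, hpn⟩, hprime, h⟩)
      · exact Or.inr (Or.inr ⟨⟨hp0, hpn⟩, hprime, h⟩)
    · right
      rcases exceptional_of_shift_eq_mul (β := β) rfl hδ hn2 htp (by omega) (by omega)
        (by push_cast; linarith) ht0 (Nat.le_sqrt'.1 htX) hty.1 hty.2 with h | h | h
      · exact Or.inl ⟨⟨hp0, hpn⟩, hprime, h⟩
      · exact Or.inr (Or.inl ⟨⟨hp0, hpn⟩, hprime, h⟩)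
      · exact Or.inr (Or.inr ⟨⟨hp0, hpn⟩, hprime, h⟩)
  have hunion : ∀ (A B : Finset ℕ) (a b : ℝ), (A.card : ℝ) ≤ a → (B.card : ℝ) ≤ b →
      ((A ∪ B).card : ℝ) ≤ a + b := by
    intro A B a b ha hb
    have : ((A ∪ B).card : ℝ) ≤ A.card + B.card := by exact_mod_cast Finset.card_union_le A B
    linarith
  have hfin := hunion _ _ _ _ b0 (hunion (W TA) _ _ _ (by convert! bA) (hunion _ _ _ _
    (hunion (W (TB fun p => p - 1)) _ _ _ (by convert! bB₁)
      (hunion (W (TC fun p => p - 1)) (W (TD fun p => p - 1)) _ _ (by convert! bC₁)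
        (by convert! bD₁)))
    (hunion (W (TB fun p => p + 1)) _ _ _ (by convert! bB₂)
      (hunion (W (TC fun p => p + 1)) (W (TD fun p => p + 1)) _ _ (by convert! bC₂)
        (by convert! bD₂)))))
  have hcard : ((smallRankPrimes n).card : ℝ) ≤ _ :=
    (Nat.cast_le.2 (Finset.card_le_card hcover)).trans hfin
  refine hcard.trans (le_of_eq ?_)
  ring

/-- Almost all primes `p ≤ n` have rank of apparition larger than `10√n`. -/
theorem eventually_card_smallRankPrimes_le {η : ℝ} (hη : 0 < η) :
    ∀ᶠ n : ℕ in atTop, ((smallRankPrimes n).card : ℝ) ≤ (n / Real.log n) * η := by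
  obtain ⟨C, hC, hmain⟩ := exists_eventually_card_smallRankPrimes_le
  set β := min (η / 1300) (1 / 2) with hβdef
  have hβ : 0 < β := lt_min (by positivity) (by norm_num)
  have hβ1 : β < 1 := (min_le_right _ _).trans_lt (by norm_num)
  have hβη : β ≤ η / 1300 := min_le_left _ _
  set δ := η / 200 with hδdef
  have hδ : 0 < δ := by positivity
  obtain ⟨r, hr⟩ := exists_nat_gt (2600 / η)
  have hr0 : (0 : ℝ) < r := lt_trans (by positivity) hr
  -- Q comes last: E must be large in terms of β, δ and η to absorb C/(βδ√E). All error terms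
  -- together then stay below η.
  obtain ⟨Q, hQ, hE⟩ := exists_primes_sum_one_div_ge r
    (max (240000 / η) ((20 * C / (β * δ * η)) ^ 2))
  set E := ∑ q ∈ Q, (1 / q : ℝ)
  have hE1 : 240000 / η ≤ E := (le_max_left _ _).trans hE
  have hE2 : (20 * C / (β * δ * η)) ^ 2 ≤ E := (le_max_right _ _).trans hE
  have hE0 : 0 < E := lt_of_lt_of_le (by positivity) hE1
  have hsE : 20 * C / (β * δ * η) ≤ √E := Real.le_sqrt_of_sq_le hE2
  have hsE0 : 0 < √E := Real.sqrt_pos.2 hE0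
  have a1 : C / (β * δ * √E) ≤ η / 20 := by
    rw [div_le_iff₀ (by positivity)]
    rw [div_le_iff₀ (by positivity)] at hsE
    nlinarith
  have a2 : 130 / (r : ℝ) ≤ η / 20 := by
    rw [div_lt_iff₀ hη] at hr
    rw [div_le_iff₀ hr0]
    linarith
  have a3 : 24000 / E ≤ η / 10 := by
    rw [div_le_iff₀ hη] at hE1
    rw [div_le_iff₀ hE0]
    linarith
  filter_upwards [hmain β δ hβ hβ1 hδ r (by exact_mod_cast hr0) Q hQ hE0,
    eventually_ge_atTop 1] with n hn hn1
  refine hn.trans (mul_le_mul_of_nonneg_left ?_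
    (div_nonneg (by positivity) (Real.log_nonneg (by exact_mod_cast hn1))))
  have a4 : 22000 / E + 2 * (975 / E) ≤ 24000 / E := by
    rw [mul_div_assoc', ← add_div]
    gcongr
    norm_num
  have : 20 * δ = η / 10 := by rw [hδdef]; ring
  linarith

end SmallRank

/-! ### Passage to real N and conclusion. -/

theorem EveryResidueSumOfSixteenFib.mono {p : ℕ} {B B' : ℝ} (h : EveryResidueSumOfSixteenFib p B)
    (hB : B ≤ B') : EveryResidueSumOfSixteenFib p B' := by
  intro a
  obtain ⟨n, hn, hs⟩ := h a
  exact ⟨n, fun i => ⟨(hn i).1, (hn i).2.trans hB⟩, hs⟩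

theorem everyResidueSumOfSixteenFib_of_notMem {n p : ℕ} (hp : p.Prime) (hp7 : 7 ≤ p) (hpn : p ≤ n)
    (h : p ∉ smallRankPrimes n) : EveryResidueSumOfSixteenFib p (10 * √(p : ℝ)) := by
  have := Fact.mk hp
  refine everyResidueSumOfSixteenFib_of_rank (z := Nat.sqrt (100 * p) + 1) hp7
    (fun k hk hkz hdvd => h ?_) (by rw [sq]; exact (Nat.lt_succ_sqrt (100 * p)).le)
  rw [mem_smallRankPrimes]
  have h1 : k ^ 2 ≤ 100 * p := Nat.le_sqrt'.1 (Nat.lt_succ_iff.1 hkz)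
  exact ⟨⟨hp.pos, hpn⟩, hp, hp7, k, hk, h1.trans (Nat.mul_le_mul_left _ hpn), hdvd⟩

theorem rpow_half_add_log_ten_div_log {x : ℝ} (hx : 1 < x) :
    x ^ ((1 : ℝ) / 2 + Real.log 10 / Real.log x) = 10 * √x := by
  have hl : Real.log x ≠ 0 := (Real.log_pos hx).ne'
  have h0 : 0 < x := by linarith
  rw [Real.rpow_add h0, ← Real.sqrt_eq_rpow, Real.rpow_def_of_pos h0 (Real.log 10 / Real.log x),
    mul_div_cancel₀ _ hl, Real.exp_log (by norm_num), mul_comm]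

/-- A prime that is not counted has small rank or is below 7. The exponent is designed so that the
index bound equals 10√N ≥ 10√p. -/
theorem card_primes_sub_card_good_le {N : ℝ} (hN : 1 < N) :
    |((Set.ncard {p : ℕ | p.Prime ∧ (p : ℝ) ≤ N ∧
        EveryResidueSumOfSixteenFib p (N ^ ((1 : ℝ) / 2 + Real.log 10 / Real.log N))} : ℝ))
      - (Nat.primeCounting ⌊N⌋₊ : ℝ)| ≤ (smallRankPrimes ⌊N⌋₊).card + 7 := by
  classical
  set n := ⌊N⌋₊
  have hle : ∀ p : ℕ, (p : ℝ) ≤ N ↔ p ≤ n := fun p => (Nat.le_floor_iff (by linarith)).symm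
  set P := (Finset.range (n + 1)).filter Nat.Prime
  have hP : (Nat.primeCounting n) = P.card := by
    rw [Nat.primeCounting, Nat.primeCounting', Nat.count_eq_card_filter_range]
  set T : ℕ → Prop := fun p =>
    EveryResidueSumOfSixteenFib p (N ^ ((1 : ℝ) / 2 + Real.log 10 / Real.log N))
  have hG : {p : ℕ | p.Prime ∧ (p : ℝ) ≤ N ∧ T p} = ((P.filter T : Finset ℕ) : Set ℕ) := by
    ext p
    simp only [P, Set.mem_ofPred_eq, Finset.coe_filter, Finset.mem_filter, Finset.mem_range, hle]
    constructor
    · rintro ⟨h1, h2, h3⟩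
      exact ⟨⟨by omega, h1⟩, h3⟩
    · rintro ⟨⟨h1, h2⟩, h3⟩
      exact ⟨h2, by omega, h3⟩
  have hsub : P.filter (fun p => ¬ T p) ⊆ smallRankPrimes n ∪ Finset.range 7 := by
    intro p hp
    simp only [P, Finset.mem_filter, Finset.mem_range] at hp
    rw [Finset.mem_union, Finset.mem_range]
    by_contra! hcon
    refine hp.2 ?_
    have h1 := everyResidueSumOfSixteenFib_of_notMem hp.1.2 hcon.2 (by omega) hcon.1
    simp only [T]
    rw [rpow_half_add_log_ten_div_log hN]
    refine h1.mono ?_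
    have : (p : ℝ) ≤ N := (hle p).2 (by omega)
    gcongr
  have hcard := (Finset.card_le_card hsub).trans (Finset.card_union_le _ _)
  rw [Finset.card_range] at hcard
  have hsplit := Finset.card_filter_add_card_filter_not (s := P) T
  rw [hG, Set.ncard_coe_finset, hP, ← hsplit, abs_sub_comm]
  push_cast
  rw [add_sub_cancel_left, abs_of_nonneg (by positivity)]
  exact_mod_cast hcard

theorem eventually_log_le_mul {c : ℝ} (hc : 0 < c) : ∀ᶠ n : ℕ in atTop, Real.log n ≤ c * n := by
  have h := tendsto_natCast_atTop_atTop.eventually (Real.isLittleO_log_id_atTop.bound hc)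
  filter_upwards [h] with n hn
  simp only [id, Real.norm_natCast] at hn
  exact (le_abs_self _).trans hn

/-- A weak Chebyshev bound, enough to turn o(n / log n) into o(π(n)). -/
theorem eventually_primeCounting_ge :
    ∀ᶠ n : ℕ in atTop, (n : ℝ) / Real.log n / 4 ≤ Nat.primeCounting n := by
  have h := (tendsto_add_atTop_nat 1).eventually
    (eventually_log_le_mul (c := 1 / 10) (by norm_num))
  filter_upwards [h, eventually_ge_atTop 2] with n hn hn2
  refine le_trans ?_ (Chebyshev.pi_ge n)
  have hl : 0 < Real.log n := Real.log_pos (by exact_mod_cast hn2)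
  have hl2 := Real.log_two_gt_d9
  have hn2' : (2 : ℝ) ≤ n := by exact_mod_cast hn2
  push_cast at hn
  rw [div_right_comm]
  gcongr
  nlinarith

theorem theorem3 :
    ∃ ε : ℝ → ℝ, Tendsto ε atTop (𝓝 0) ∧
      (fun N : ℝ => (Set.ncard {p : ℕ | p.Prime ∧ (p : ℝ) ≤ N ∧
          EveryResidueSumOfSixteenFib p (N ^ ((1 : ℝ) / 2 + ε N))} : ℝ))
        ~[atTop] (fun N : ℝ => (Nat.primeCounting ⌊N⌋₊ : ℝ)) := by
  refine ⟨fun N => Real.log 10 / Real.log N, Real.tendsto_log_atTop.const_div_atTop _, ?_⟩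
  refine isLittleO_iff.2 fun c hc => ?_
  -- The small-rank primes and the constant 7 each take at most (c/8) n / log n, and π(n) ≥ n / (4
  -- log n).
  have h1 : ∀ᶠ n : ℕ in atTop,
      ((smallRankPrimes n).card : ℝ) + 7 ≤ c * Nat.primeCounting n := by
    filter_upwards [eventually_card_smallRankPrimes_le (η := c / 8) (by positivity),
      eventually_log_le_mul (c := c / 56) (by positivity), eventually_primeCounting_ge,
      eventually_ge_atTop 2] with n h2 h3 h4 hn2
    have hl : 0 < Real.log n := Real.log_pos (by exact_mod_cast hn2)
    have h5 : 7 ≤ (n / Real.log n) * (c / 8) := by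
      rw [div_mul_eq_mul_div, le_div_iff₀ hl]
      linarith
    nlinarith
  filter_upwards [tendsto_nat_floor_atTop.eventually h1, eventually_gt_atTop 1] with N hN hN1
  rw [Pi.sub_apply, Real.norm_eq_abs, Real.norm_natCast]
  exact (card_primes_sub_card_good_le hN1).trans hN
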